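/- Let $\mathscr A$ be a complex Banach algebra with an involution $*$ (a Banach $^*$-algebra, not assumed unital; no compatibility of the norm with the involution is assumed). Suppose that $\mathscr A$ has a norm bounded two-sided approximate unit $(e_i)_{i\in I}$, i.e. a net with $\sup_i\|e_i\|<\infty$, $e_ia\to a$ and $ae_i\to a$ for all $a\in\mathscr A$. Let $f,g$ be positive linear functionals on $\mathscr A$, i.e. $f(a^*a)\ge0$ and $g(a^*a)\ge 0$ for all $a\in\mathscr A$. Inner products are linear in the first variable. Then $f$ and $g$ are representable, that is, of the form $a\mapsto(\pi(a)\zeta\,|\,\zeta)$ for a $^*$-representation $\pi$ of $\mathscr A$ by bounded operators on a Hilbert space and a vector $\zeta$; and the formulas $\langle Aa,b\rangle=f(b^*a)$, $\langle Ba,b\rangle=g(b^*a)$ define bounded positive operators $A,B$ from $\mathscr A$ into the space $\bar{\mathscr A}'$ of continuous conjugate linear functionals on $\mathscr A$. Moreover, the parallel sum $f:g$ is continuous and $$f:g=\lim_{i\in I}\overline{(A:B)e_i}\qquad\text{in functional norm},$$ where $\overline{\varphi}(a)=\overline{\varphi(a)}$. Here the parallel sums are defined as follows. Let $(H_f,\pi_f,\zeta_f)$,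 $(H_g,\pi_g,\zeta_g)$ be the GNS triples of $f$ and $g$, let $\pi=\pi_f\oplus\pi_g$, and let $P$ be the orthogonal projection of $H_f\oplus H_g$ onto the orthogonal complement of $\{\pi_f(a)\zeta_f\oplus\pi_g(a)\zeta_g : a\in\mathscr A\}$. Then $(f:g)(a)=(\pi(a)P(\zeta_f\oplus0)\,|\,P(\zeta_f\oplus0))$ for $a\in\mathscr A$. Next, for bounded positive operators $A,B:E\to\bar E'$ ($E$ a complex Banach space), let $H_A$ be the completion of $\operatorname{ran}A$ under $(Ax\,|\,Ay)_A=\langle Ax,y\rangle$ and let $J_A:H_A\to\bar E'$ be the continuous extension of $Ax\mapsto Ax$; define $H_B,J_B$ likewise. Let $j:E\to\bar E''$ be the canonical embedding of $E$ into its anti-bidual, $\langle jx,\varphi\rangle=\overline{\langle\varphi,x\rangle}$. On $H_A\times H_B$ put $\widetilde J_A(h,k)=J_Ah$ and $J(h,k)=J_Ah+J_Bk$, and let $Q$ be the orthogonal projection onto the orthogonal complement of $\operatorname{ran}(J^*\circ j)$. Then $A:B=\widetilde J_A\,Q\,\widetilde J_A^*\circ j$. -/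

import Mathlib

open Filter Topology UniformSpace
open scoped ComplexOrder InnerProductSpace

noncomputable section

namespace ParallelSum

universe u v w

/-! ### The Hilbert space of a nonnegative Hermitian form -/

section Form

variable {V : Type u} [AddCommGroup V] [Module ℂ V]

/-- A nonnegative sesquilinear form `t(x, y)` on a complex vector space, linear in `x` and
conjugate linear in `y`. It is automatically Hermitian, see `NonnegForm.conj_symm`. -/
structure NonnegForm (V : Type u) [AddCommGroup V] [Module ℂ V] where
  /-- the underlying sesquilinear map -/
  toMap : V →ₗ[ℂ] V →ₗ⋆[ℂ] ℂ
  nonneg : ∀ x, 0 ≤ toMap x x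

theorem NonnegForm.conj_symm (t : NonnegForm V) (x y : V) :
    (starRingEnd ℂ) (t.toMap x y) = t.toMap y x := by
  have hx := (Complex.nonneg_iff.1 (t.nonneg x)).2
  have hy := (Complex.nonneg_iff.1 (t.nonneg y)).2
  have h1 := (Complex.nonneg_iff.1 (t.nonneg (x + y))).2
  have h2 := (Complex.nonneg_iff.1 (t.nonneg (x + Complex.I • y))).2
  simp only [map_add, map_smul, LinearMap.add_apply, LinearMap.smul_apply, map_smulₛₗ,
    Complex.conj_I, smul_eq_mul, Complex.add_im, Complex.add_re, Complex.mul_im, Complex.mul_re, Complex.I_re,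
    Complex.I_im, Complex.neg_re, Complex.neg_im] at h1 h2
  apply Complex.ext
  · rw [Complex.conj_re]; linarith
  · rw [Complex.conj_im]; linarith

set_option linter.unusedVariables false in
/-- The vector space `V` with the semi-inner product given by the form `t`
(a type synonym of `V`). -/
@[nolint unusedArguments]
def PreHilb (t : NonnegForm V) : Type u := V

instance (t : NonnegForm V) : AddCommGroup (PreHilb t) := inferInstanceAs (AddCommGroup V)
instance (t : NonnegForm V) : Module ℂ (PreHilb t) := inferInstanceAs (Module ℂ V)

/-- The identity map of `V`, as a map into the semi-inner product space. -/
def toPre (t : NonnegForm V) : V ≃ₗ[ℂ] PreHilb t := LinearEquiv.refl ℂ V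

/-- The semi-inner product. Mathlib's inner products are linear in the second variable, so
`⟪y, x⟫ = t(x, y)`. -/
abbrev preCore (t : NonnegForm V) : PreInnerProductSpace.Core ℂ (PreHilb t) where
  inner y x := t.toMap ((toPre t).symm x) ((toPre t).symm y)
  conj_inner_symm _ _ := t.conj_symm _ _
  re_inner_nonneg _ := (Complex.nonneg_iff.1 (t.nonneg _)).1
  add_left _ _ _ := by simp
  smul_left _ _ _ := by simp

instance (t : NonnegForm V) : SeminormedAddCommGroup (PreHilb t) :=
  InnerProductSpace.Core.toSeminormedAddCommGroup (c := preCore t)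
instance (t : NonnegForm V) : InnerProductSpace ℂ (PreHilb t) :=
  InnerProductSpace.ofCore (preCore t)

/-- The Hilbert space associated with the form `t`: the completion of the quotient of `V` by the
null space of `t` under the inner product induced by `t`. (`UniformSpace.Completion` is the
Hausdorff completion, so that vectors at distance zero are identified.) -/
abbrev Hilb (t : NonnegForm V) : Type u := Completion (PreHilb t)

theorem pre_inner (t : NonnegForm V) (x y : V) :
    ⟪toPre t y, toPre t x⟫_ℂ = t.toMap x y := rfl

/-- The canonical linear map `V → Hilb t` (the class of a vector). -/
def cls (t : NonnegForm V) : V →ₗ[ℂ] Hilb t :=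
  (Completion.toComplL (𝕜 := ℂ) (E := PreHilb t)).toLinearMap ∘ₗ (toPre t).toLinearMap

theorem cls_apply (t : NonnegForm V) (x : V) : cls t x = ((toPre t x : PreHilb t) : Hilb t) := rfl

theorem cls_inner (t : NonnegForm V) (x y : V) : ⟪cls t y, cls t x⟫_ℂ = t.toMap x y := by
  rw [cls_apply, cls_apply, Completion.inner_coe, pre_inner]

theorem cls_norm_sq (t : NonnegForm V) (x : V) : ‖cls t x‖ ^ 2 = (t.toMap x x).re := by
  rw [← cls_inner, inner_self_eq_norm_sq_to_K]
  norm_cast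

theorem cls_dense (t : NonnegForm V) : DenseRange (cls t) := by
  have h : (cls t : V → Hilb t) = (fun x : PreHilb t => (x : Hilb t)) ∘ toPre t := rfl
  rw [h]
  exact Completion.denseRange_coe.comp (toPre t).surjective.denseRange
    (Completion.continuous_coe _)

end Form

/-- The orthogonal projection of a Hilbert space onto the orthogonal complement of `K`. -/
def projOrth {H : Type u} [NormedAddCommGroup H] [InnerProductSpace ℂ H] [CompleteSpace H]
    (K : Submodule ℂ H) : H →L[ℂ] H := Kᗮ.starProjection

/-! ### The parallel sum of positive operators from a Banach space into its antidual -/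

section Operators

variable {E : Type u} [NormedAddCommGroup E] [NormedSpace ℂ E]

/-- The topological antidual of `E`: the continuous conjugate linear functionals on `E`, with the
functional norm. -/
abbrev Antidual (E : Type u) [NormedAddCommGroup E] [NormedSpace ℂ E] : Type u := E →L⋆[ℂ] ℂ

/-- Bounded positive operators `A : E → Antidual E`, that is, `⟨A x, x⟩ ≥ 0` for all `x`. -/
structure PosOp (E : Type u) [NormedAddCommGroup E] [NormedSpace ℂ E] where
  /-- the underlying bounded operator -/
  op : E →L[ℂ] Antidual E
  nonneg : ∀ x, 0 ≤ op x x

/-- The form `t_A(x, y) = ⟨A x, y⟩` of a positive operator. -/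
def PosOp.form (A : PosOp E) : NonnegForm E where
  toMap :=
    { toFun := fun x => (A.op x).toLinearMap
      map_add' := fun x y => by ext; simp
      map_smul' := fun c x => by ext; simp }
  nonneg := A.nonneg

theorem PosOp.form_apply (A : PosOp E) (x y : E) : A.form.toMap x y = A.op x y := rfl

/-- The Hilbert space `H_A`, the completion of `ran A` under `(A x | A y) = ⟨A x, y⟩`. The element
`A x` of `ran A` is the class of `x`; `PosOp.emb_eq_iff` shows that this is a faithful
identification. -/
abbrev PosOp.H (A : PosOp E) : Type u := Hilb A.form

/-- The map `E → H_A` that sends `x` to the element `A x` of the dense subspace `ran A`. -/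
def PosOp.emb (A : PosOp E) : E →L[ℂ] A.H :=
  (cls A.form).mkContinuous (Real.sqrt ‖A.op‖) fun x => by
    have h : ‖cls A.form x‖ ^ 2 ≤ ‖A.op‖ * ‖x‖ ^ 2 := by
      rw [cls_norm_sq, PosOp.form_apply]
      calc (A.op x x).re ≤ ‖A.op x x‖ := Complex.re_le_norm _
        _ ≤ ‖A.op x‖ * ‖x‖ := (A.op x).le_opNorm x
        _ ≤ ‖A.op‖ * ‖x‖ * ‖x‖ := by gcongr; exact A.op.le_opNorm x
        _ = ‖A.op‖ * ‖x‖ ^ 2 := by ring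
    calc ‖cls A.form x‖ = Real.sqrt (‖cls A.form x‖ ^ 2) := (Real.sqrt_sq (norm_nonneg _)).symm
      _ ≤ Real.sqrt (‖A.op‖ * ‖x‖ ^ 2) := Real.sqrt_le_sqrt h
      _ = Real.sqrt ‖A.op‖ * ‖x‖ := by
        rw [Real.sqrt_mul (norm_nonneg A.op), Real.sqrt_sq (norm_nonneg x)]

theorem PosOp.emb_inner (A : PosOp E) (x y : E) : ⟪A.emb y, A.emb x⟫_ℂ = A.op x y :=
  cls_inner A.form x y

/-- The operator `J_A : H_A → Antidual E`, `⟨J_A h, x⟩ = (h | A x)`. By `PosOp.J_emb` and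
density it is the continuous extension of the identical embedding `A x ↦ A x` of `ran A`. -/
def PosOp.J (A : PosOp E) : A.H →L[ℂ] Antidual E :=
  ((innerSL ℂ).comp A.emb).flip

theorem PosOp.J_apply (A : PosOp E) (h : A.H) (x : E) : A.J h x = ⟪A.emb x, h⟫_ℂ := rfl

theorem PosOp.J_emb (A : PosOp E) (x : E) : A.J (A.emb x) = A.op x := by
  ext y
  rw [PosOp.J_apply, PosOp.emb_inner]

theorem PosOp.emb_eq_iff (A : PosOp E) (x y : E) : A.emb x = A.emb y ↔ A.op x = A.op y := by
  constructor
  · intro h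
    rw [← A.J_emb, h, A.J_emb]
  · intro h
    have h0 : A.op (x - y) = 0 := by rw [map_sub, h, sub_self]
    rw [← sub_eq_zero, ← map_sub, ← inner_self_eq_zero (𝕜 := ℂ), PosOp.emb_inner, h0]
    rfl

/-- For a bounded operator `T` of a Hilbert space `H` into the antidual of `E`, the map `T* ∘ j`,
where `j` is the canonical embedding of `E` into the anti-bidual of `E`, `⟨j x, f⟩ = conj ⟨f, x⟩`,
and `T*` is the adjoint of `T`, `(T* φ | h) = ⟨φ, T h⟩`.
Hence `(T* (j x) | h) = conj ⟨T h, x⟩`, which is `adjJ_inner`. -/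
def adjJ {H : Type v} [NormedAddCommGroup H] [InnerProductSpace ℂ H] [CompleteSpace H]
    (T : H →L[ℂ] Antidual E) : E →L[ℂ] H :=
  ((InnerProductSpace.toDual ℂ H).symm.toContinuousLinearEquiv : (H →L[ℂ] ℂ) →L⋆[ℂ] H).comp T.flip

theorem adjJ_inner {H : Type v} [NormedAddCommGroup H] [InnerProductSpace ℂ H] [CompleteSpace H]
    (T : H →L[ℂ] Antidual E) (x : E) (h : H) : ⟪adjJ T x, h⟫_ℂ = T h x :=
  InnerProductSpace.toDual_symm_apply (𝕜 := ℂ) (y := T.flip x) (x := h)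

/-- `H_A × H_B`, as a Hilbert space. -/
abbrev HProd (A B : PosOp E) : Type u := WithLp 2 (A.H × B.H)

/-- `J̃_A (A x, B y) = A x`. -/
def JtildeL (A B : PosOp E) : HProd A B →L[ℂ] Antidual E := A.J.comp (WithLp.fstL 2 ℂ A.H B.H)

/-- `J̃_B (A x, B y) = B y`. -/
def JtildeR (A B : PosOp E) : HProd A B →L[ℂ] Antidual E := B.J.comp (WithLp.sndL 2 ℂ A.H B.H)

/-- `J (A x, B y) = A x + B y`. -/
def JSum (A B : PosOp E) : HProd A B →L[ℂ] Antidual E := JtildeL A B + JtildeR A B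

theorem adjJ_JtildeL (A B : PosOp E) (x : E) :
    adjJ (JtildeL A B) x = WithLp.toLp 2 (A.emb x, 0) := by
  refine ext_inner_right ℂ fun h => ?_
  rw [adjJ_inner, WithLp.prod_inner_apply, inner_zero_left, add_zero]
  rfl

theorem adjJ_JSum (A B : PosOp E) (x : E) :
    adjJ (JSum A B) x = WithLp.toLp 2 (A.emb x, B.emb x) := by
  refine ext_inner_right ℂ fun h => ?_
  rw [adjJ_inner, WithLp.prod_inner_apply]
  rfl

/-- The subspace `ran (J* ∘ j)` of `H_A × H_B`. -/
def ranJ (A B : PosOp E) : Submodule ℂ (HProd A B) := LinearMap.range (adjJ (JSum A B)).toLinearMap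

/-- The orthogonal projection of `H_A × H_B` onto the orthogonal complement of `ran (J* ∘ j)`. -/
def opProj (A B : PosOp E) : HProd A B →L[ℂ] HProd A B := projOrth (ranJ A B)

/-- The parallel sum `A : B = J̃_A P J̃_A* ∘ j` of two positive operators, as a bounded operator
from `E` into its antidual. -/
def PosOp.parallelSum (A B : PosOp E) : E →L[ℂ] Antidual E :=
  (JtildeL A B).comp ((opProj A B).comp (adjJ (JtildeL A B)))

/-- The conjugate `a ↦ conj (φ a)` of a conjugate linear functional. -/
def conjFunctional (φ : Antidual E) : E →L[ℂ] ℂ where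
  toFun a := (starRingEnd ℂ) (φ a)
  map_add' := by simp
  map_smul' := by simp
  cont := Complex.continuous_conj.comp φ.continuous

end Operators

/-! ### The parallel sum of representable positive functionals -/

section Functionals

set_option linter.unusedSectionVars false

variable {𝔄 : Type u} [NonUnitalRing 𝔄] [Module ℂ 𝔄] [IsScalarTower ℂ 𝔄 𝔄] [SMulCommClass ℂ 𝔄 𝔄]
  [StarRing 𝔄] [StarModule ℂ 𝔄]

/-- Positivity of a linear functional: `f (a* a) ≥ 0` for all `a`. -/
def IsPosFunctional (f : 𝔄 →ₗ[ℂ] ℂ) : Prop := ∀ a, 0 ≤ f (star a * a)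

/-- A functional is representable if it has the form `f a = (π a ζ | ζ)` for a `*`-representation
`π` by bounded operators on a Hilbert space and some vector `ζ`. -/
def IsRepresentable (f : 𝔄 →ₗ[ℂ] ℂ) : Prop :=
  ∃ (H : Type u) (_ : NormedAddCommGroup H) (_ : InnerProductSpace ℂ H) (_ : CompleteSpace H)
    (π : 𝔄 →⋆ₙₐ[ℂ] (H →L[ℂ] H)) (ζ : H), ∀ a, f a = ⟪ζ, π a ζ⟫_ℂ

theorem IsRepresentable.isPos {f : 𝔄 →ₗ[ℂ] ℂ} (hf : IsRepresentable f) : IsPosFunctional f := by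
  obtain ⟨H, _, _, _, π, ζ, h⟩ := hf
  intro a
  rw [h, map_mul, map_star, mul_apply_eq_comp, ContinuousLinearMap.star_eq_adjoint,
    ContinuousLinearMap.adjoint_inner_right, inner_self_eq_norm_sq_to_K]
  norm_cast
  positivity

theorem IsRepresentable.cyclic_bound {f : 𝔄 →ₗ[ℂ] ℂ} (hf : IsRepresentable f) :
    ∃ C : ℝ, 0 ≤ C ∧ ∀ a, ‖f a‖ ≤ C * Real.sqrt (f (star a * a)).re := by
  obtain ⟨H, _, _, _, π, ζ, h⟩ := hf
  refine ⟨‖ζ‖, norm_nonneg _, fun a => ?_⟩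
  have h2 : (f (star a * a)).re = ‖π a ζ‖ ^ 2 := by
    rw [h, map_mul, map_star, mul_apply_eq_comp, ContinuousLinearMap.star_eq_adjoint,
      ContinuousLinearMap.adjoint_inner_right, inner_self_eq_norm_sq_to_K]
    norm_cast
  rw [h2, Real.sqrt_sq (norm_nonneg _), h]
  exact norm_inner_le_norm _ _

theorem IsRepresentable.mul_bound {f : 𝔄 →ₗ[ℂ] ℂ} (hf : IsRepresentable f) (a : 𝔄) :
    ∃ M : ℝ, 0 ≤ M ∧ ∀ b, Real.sqrt (f (star (a * b) * (a * b))).re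
      ≤ M * Real.sqrt (f (star b * b)).re := by
  obtain ⟨H, _, _, _, π, ζ, h⟩ := hf
  refine ⟨‖π a‖, norm_nonneg _, fun b => ?_⟩
  have h2 : ∀ a, Real.sqrt (f (star a * a)).re = ‖π a ζ‖ := by
    intro a
    rw [← Real.sqrt_sq (norm_nonneg (π a ζ)), h, map_mul, map_star, mul_apply_eq_comp,
      ContinuousLinearMap.star_eq_adjoint,
      ContinuousLinearMap.adjoint_inner_right, inner_self_eq_norm_sq_to_K]
    norm_cast
  rw [h2, h2, map_mul, mul_apply_eq_comp]
  exact (π a).le_opNorm _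

/-- The form `t_f(a, b) = f (b* a)` of a positive functional. -/
def functionalForm (f : 𝔄 →ₗ[ℂ] ℂ) (hf : IsPosFunctional f) : NonnegForm 𝔄 where
  toMap :=
    { toFun := fun a =>
        { toFun := fun b => f (star b * a)
          map_add' := fun b c => by rw [star_add, add_mul, map_add]
          map_smul' := fun c b => by
            rw [star_smul, smul_mul_assoc, map_smul]; rfl }
      map_add' := fun a b => by ext c; simp [mul_add]
      map_smul' := fun c a => by ext b; simp [mul_smul_comm] }
  nonneg := hf

variable {f g : 𝔄 →ₗ[ℂ] ℂ}

/-- The Hilbert space `H_f` of the Gelfand–Naimark–Segal construction. -/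
abbrev gnsH (hf : IsRepresentable f) : Type u := Hilb (functionalForm f hf.isPos)

/-- The class of an element `a` in `H_f`, so that `(gnsCls a | gnsCls b) = f (b* a)`. -/
abbrev gnsCls (hf : IsRepresentable f) : 𝔄 →ₗ[ℂ] gnsH hf := cls (functionalForm f hf.isPos)

theorem gnsCls_inner (hf : IsRepresentable f) (a b : 𝔄) :
    ⟪gnsCls hf b, gnsCls hf a⟫_ℂ = f (star b * a) := cls_inner _ a b

theorem pre_norm (hf : IsRepresentable f) (b : PreHilb (functionalForm f hf.isPos)) :
    ‖b‖ = Real.sqrt (f (star ((toPre _).symm b) * (toPre _).symm b)).re := rfl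

/-- Left multiplication by `a` on the pre-Hilbert space of `f`. -/
def gnsPre (hf : IsRepresentable f) (a : 𝔄) :
    PreHilb (functionalForm f hf.isPos) →L[ℂ] PreHilb (functionalForm f hf.isPos) :=
  LinearMap.mkContinuousOfExistsBound
    ((toPre _).toLinearMap ∘ₗ LinearMap.mulLeft ℂ a ∘ₗ (toPre _).symm.toLinearMap) <| by
    obtain ⟨M, -, hM⟩ := hf.mul_bound a
    exact ⟨M, fun b => hM _⟩

/-- The operator `π_f(a)` on `H_f`: the continuous extension of `[b] ↦ [a b]`. -/
def gnsOp (hf : IsRepresentable f) (a : 𝔄) : gnsH hf →L[ℂ] gnsH hf := (gnsPre hf a).completion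

theorem gnsOp_cls (hf : IsRepresentable f) (a b : 𝔄) :
    gnsOp hf a (gnsCls hf b) = gnsCls hf (a * b) :=
  ContinuousLinearMap.completion_apply_coe _ _

theorem gns_ext (hf : IsRepresentable f) {S T : gnsH hf →L[ℂ] gnsH hf}
    (h : ∀ b, S (gnsCls hf b) = T (gnsCls hf b)) : S = T :=
  ContinuousLinearMap.ext <| congrFun <|
    (cls_dense (functionalForm f hf.isPos)).equalizer S.continuous T.continuous (funext h)

/-- The GNS representation `π_f`. -/
def gnsRep (hf : IsRepresentable f) : 𝔄 →⋆ₙₐ[ℂ] (gnsH hf →L[ℂ] gnsH hf) where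
  toFun := gnsOp hf
  map_smul' c a := gns_ext hf fun b => by
    rw [gnsOp_cls, smul_mul_assoc, map_smul]
    exact congrArg (c • ·) (gnsOp_cls hf a b).symm
  map_zero' := gns_ext hf fun b => by rw [gnsOp_cls, zero_mul, map_zero]; rfl
  map_add' a a' := gns_ext hf fun b => by
    rw [gnsOp_cls, add_mul, map_add, add_apply, gnsOp_cls, gnsOp_cls]
  map_mul' a a' := gns_ext hf fun b => by
    rw [gnsOp_cls, mul_apply_eq_comp, gnsOp_cls, gnsOp_cls, mul_assoc]
  map_star' a := by
    rw [ContinuousLinearMap.star_eq_adjoint, ContinuousLinearMap.eq_adjoint_iff]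
    intro x y
    refine (cls_dense (functionalForm f hf.isPos)).induction_on₂
      (p := fun x y => ⟪gnsOp hf (star a) x, y⟫_ℂ = ⟪x, gnsOp hf a y⟫_ℂ) ?_ ?_ x y
    · exact isClosed_eq (by fun_prop) (by fun_prop)
    · intro b c
      rw [gnsOp_cls, gnsOp_cls, gnsCls_inner, gnsCls_inner, star_mul, star_star, mul_assoc]

/-- The continuous functional `[a] ↦ f a` on `H_f`. -/
def gnsFunctional (hf : IsRepresentable f) : gnsH hf →L[ℂ] ℂ :=
  (LinearMap.mkContinuousOfExistsBound (f ∘ₗ (toPre (functionalForm f hf.isPos)).symm.toLinearMap)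
    (by
      obtain ⟨C, -, hC⟩ := hf.cyclic_bound
      exact ⟨C, fun b => hC _⟩)).fromCompletion

theorem gnsFunctional_cls (hf : IsRepresentable f) (a : 𝔄) :
    gnsFunctional hf (gnsCls hf a) = f a :=
  ContinuousLinearMap.fromCompletion_apply_coe _ _

/-- The GNS vector `ζ_f`, the Riesz representative of `[a] ↦ f a`: `([a] | ζ_f) = f a`. -/
def gnsVec (hf : IsRepresentable f) : gnsH hf :=
  (InnerProductSpace.toDual ℂ (gnsH hf)).symm (gnsFunctional hf)

theorem gnsVec_inner (hf : IsRepresentable f) (a : 𝔄) : ⟪gnsVec hf, gnsCls hf a⟫_ℂ = f a := by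
  rw [gnsVec, InnerProductSpace.toDual_symm_apply, gnsFunctional_cls]

theorem gnsRep_gnsVec (hf : IsRepresentable f) (a : 𝔄) :
    gnsRep hf a (gnsVec hf) = gnsCls hf a := by
  refine (cls_dense (functionalForm f hf.isPos)).eq_of_inner_left ℂ fun b => ?_
  have h : gnsRep hf a = star (gnsRep hf (star a)) := by rw [map_star, star_star]
  rw [h, ContinuousLinearMap.star_eq_adjoint, ContinuousLinearMap.adjoint_inner_left]
  change ⟪gnsVec hf, gnsOp hf (star a) (gnsCls hf b)⟫_ℂ = _
  rw [gnsOp_cls, gnsVec_inner, gnsCls_inner]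

/-- The GNS triple reproduces the functional: `f a = (π_f(a) ζ_f | ζ_f)`. -/
theorem gns_reproduces (hf : IsRepresentable f) (a : 𝔄) :
    f a = ⟪gnsVec hf, gnsRep hf a (gnsVec hf)⟫_ℂ := by
  rw [gnsRep_gnsVec, gnsVec_inner]

/-- `H_f ⊕ H_g`, the Hilbert space direct sum. -/
abbrev gnsSum (hf : IsRepresentable f) (hg : IsRepresentable g) : Type u :=
  WithLp 2 (gnsH hf × gnsH hg)

/-- The operator `π(a)` of the direct sum representation `π = π_f ⊕ π_g`. -/
def sumRep (hf : IsRepresentable f) (hg : IsRepresentable g) (a : 𝔄) :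
    gnsSum hf hg →L[ℂ] gnsSum hf hg :=
  ((WithLp.prodContinuousLinearEquiv 2 ℂ (gnsH hf) (gnsH hg)).symm :
      gnsH hf × gnsH hg →L[ℂ] gnsSum hf hg).comp
    (((gnsRep hf a).prodMap (gnsRep hg a)).comp
      (WithLp.prodContinuousLinearEquiv 2 ℂ (gnsH hf) (gnsH hg) :
        gnsSum hf hg →L[ℂ] gnsH hf × gnsH hg))

theorem sumRep_apply (hf : IsRepresentable f) (hg : IsRepresentable g) (a : 𝔄)
    (v : gnsSum hf hg) :
    sumRep hf hg a v = WithLp.toLp 2 (gnsRep hf a v.fst, gnsRep hg a v.snd) := rfl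

/-- The subspace `{π_f(a) ζ_f ⊕ π_g(a) ζ_g | a ∈ 𝔄}` of `H_f ⊕ H_g`. -/
def diagSubspace (hf : IsRepresentable f) (hg : IsRepresentable g) :
    Submodule ℂ (gnsSum hf hg) where
  carrier := {v | ∃ a : 𝔄, v = WithLp.toLp 2 (gnsRep hf a (gnsVec hf), gnsRep hg a (gnsVec hg))}
  zero_mem' := ⟨0, by simp; rfl⟩
  add_mem' := by
    rintro _ _ ⟨a, rfl⟩ ⟨b, rfl⟩
    exact ⟨a + b, by simp [map_add, ← WithLp.toLp_add]⟩
  smul_mem' := by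
    rintro c _ ⟨a, rfl⟩
    exact ⟨c • a, by simp [map_smul, ← WithLp.toLp_smul]⟩

/-- The vector `P (ζ_f ⊕ 0)`, where `P` is the orthogonal projection onto the orthogonal complement
of (the closure of) `diagSubspace`. -/
def projVec (hf : IsRepresentable f) (hg : IsRepresentable g) : gnsSum hf hg :=
  projOrth (diagSubspace hf hg).topologicalClosure (WithLp.toLp 2 (gnsVec hf, 0))

/-- The parallel sum `f : g` of two representable functionals,
`(f : g)(a) = (π(a) P(ζ_f ⊕ 0) | P(ζ_f ⊕ 0))`. -/
def functionalParallelSum (hf : IsRepresentable f) (hg : IsRepresentable g) : 𝔄 →ₗ[ℂ] ℂ where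
  toFun a := ⟪projVec hf hg, sumRep hf hg a (projVec hf hg)⟫_ℂ
  map_add' a b := by
    simp only [sumRep_apply, map_add, WithLp.prod_inner_apply, add_apply,
      inner_add_right]
    ring
  map_smul' c a := by
    simp only [sumRep_apply, map_smul, WithLp.prod_inner_apply, smul_apply,
      inner_smul_right, RingHom.id_apply, smul_eq_mul]
    ring

end Functionals

/-- `(e i)` is an approximate unit of the normed algebra `𝔄`: a norm bounded net with
`e i * a → a` and `a * e i → a` for all `a`. -/
structure IsApproxUnit {𝔄 : Type u} [NonUnitalNormedRing 𝔄] {I : Type w} [Preorder I]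
    (e : I → 𝔄) : Prop where
  bounded : ∃ C : ℝ, ∀ i, ‖e i‖ ≤ C
  tendsto_left : ∀ a, Tendsto (fun i => e i * a) atTop (𝓝 a)
  tendsto_right : ∀ a, Tendsto (fun i => a * e i) atTop (𝓝 a)

end ParallelSum

end

/-! Both parallel sums come from one Hilbert-space picture. Write [a] for the class of a in H_f.
Since π_f(a)ζ_f = [a], the GNS subspace is the diagonal {([a],[a])}, and so is ran(J* ∘ j) because A
and f have the same form (`diagSubspace_eq`, `PosOp.parallelSum_apply`). Let P be the projection
onto its complement. The diagonal is invariant under π, hence (f:g)(a) = ([a] ⊕ 0 | P(ζ_f ⊕ 0)),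
while the conjugate of (A:B)e_i at a is ([a] ⊕ 0 | P([e_i] ⊕ 0)). As a ↦ [a] is bounded, norm
convergence follows from [e_i] = π_f(e_i)ζ_f → ζ_f (`tendsto_gnsCls`).

The analytic work lies in the boundedness of positive functionals when the involution may be
discontinuous. Ford's square root gives f(d*hd) ≤ ‖h‖ f(d*d) for self-adjoint h, so ‖[ad]‖² ≤ ‖a*a‖
‖[d]‖². An open mapping argument on the closed graph of the involution turns ‖a*a‖ into a multiple
of ‖a‖² (`exists_seminorm_bound_of_sq_le`). Thus a ↦ f(cad) is continuous for all c and d, and Cohen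
factorization of null sequences removes c and d (Varopoulos). The closed graph theorem then bounds a
↦ [a], and the approximate unit bounds |f(a)| by a multiple of ‖[a]‖, which yields representability.
-/

namespace ParallelSum


/-! ### Self-adjoint quasi square roots -/

section SquareRoot

open scoped NNReal ENNReal

/-- If the spectral radius is smaller than `r`, the powers are `O(r ^ n)`. -/
theorem exists_norm_pow_le_of_spectralRadius_lt {R : Type*} [NormedRing R] [NormedAlgebra ℂ R]
    [CompleteSpace R] {w : R} {r : ℝ} (hr : 0 < r)
    (h : spectralRadius ℂ w < ENNReal.ofReal r) :
    ∃ M : ℝ, 0 < M ∧ ∀ n : ℕ, ‖w ^ n‖ ≤ M * r ^ n := by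
  -- Gelfand's formula gives the bound for large n; the finitely many other n are absorbed into M.
  have h1 := (spectrum.pow_norm_pow_one_div_tendsto_nhds_spectralRadius w).eventually_lt_const h
  have h2 : (fun n : ℕ => w ^ n) =O[atTop] fun n : ℕ => r ^ n := by
    refine Asymptotics.IsBigO.of_bound 1 ?_
    filter_upwards [h1, eventually_ge_atTop 1] with n hn hn1
    have hn' := (ENNReal.ofReal_lt_ofReal_iff hr).1 hn
    have hn0 : (n : ℝ) ≠ 0 := by positivity
    rw [one_mul, Real.norm_of_nonneg (pow_nonneg hr.le n)]
    calc ‖w ^ n‖ = (‖w ^ n‖ ^ (1 / n : ℝ)) ^ n := by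
          rw [← Real.rpow_natCast, ← Real.rpow_mul (norm_nonneg _), one_div_mul_cancel hn0,
            Real.rpow_one]
      _ ≤ r ^ n := by gcongr
  obtain ⟨M, hM, hM'⟩ := Asymptotics.bound_of_isBigO_nat_atTop h2
  refine ⟨M, hM, fun n => (hM' (pow_ne_zero n hr.ne')).trans_eq ?_⟩
  rw [Real.norm_of_nonneg (pow_nonneg hr.le n)]

theorem norm_add_pow_le_of_commute {R : Type*} [NormedRing R] {v w : R} (hvw : Commute v w)
    {ρ r K M : ℝ} (hρ : 0 ≤ ρ) (hv : ∀ n : ℕ, ‖v ^ n‖ ≤ K * ρ ^ n)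
    (hw : ∀ n : ℕ, ‖w ^ n‖ ≤ M * r ^ n) (n : ℕ) : ‖(v + w) ^ n‖ ≤ K * M * (ρ + r) ^ n := by
  have hK : 0 ≤ K := by simpa using (norm_nonneg _).trans (hv 0)
  rw [hvw.add_pow, add_pow, Finset.mul_sum]
  refine norm_sum_le_of_le _ fun m _ => ?_
  calc ‖v ^ m * w ^ (n - m) * (n.choose m : R)‖
      = ‖(n.choose m) • (v ^ m * w ^ (n - m))‖ := by rw [nsmul_eq_mul, Nat.cast_comm]
    _ ≤ (n.choose m) * (‖v ^ m‖ * ‖w ^ (n - m)‖) := by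
        refine (norm_nsmul_le).trans ?_
        gcongr
        exact norm_mul_le _ _
    _ ≤ (n.choose m) * ((K * ρ ^ m) * (M * r ^ (n - m))) := by
        have := hv m
        have := hw (n - m)
        gcongr
    _ = _ := by ring

/-- If `x = ((v + w) / 2) x` for commuting `v`, `w` with `ρ + r < 2`, then `x = 0`. -/
theorem eq_zero_of_add_mul_eq_two_smul {R : Type*} [NormedRing R] [NormedAlgebra ℂ R] {v w x : R}
    (hvw : Commute v w)
    {ρ r K M : ℝ} (hρ : 0 ≤ ρ) (hr : 0 ≤ r) (hv : ∀ n : ℕ, ‖v ^ n‖ ≤ K * ρ ^ n)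
    (hw : ∀ n : ℕ, ‖w ^ n‖ ≤ M * r ^ n) (h2 : ρ + r < 2) (hx : (v + w) * x = (2 : ℂ) • x) :
    x = 0 := by
  have hpow : ∀ n : ℕ, (v + w) ^ n * x = ((2 : ℂ) ^ n) • x := by
    intro n
    induction n with
    | zero => simp
    | succ n ih => rw [pow_succ, mul_assoc, hx, mul_smul_comm, ih, smul_smul, pow_succ']
  have hb : ∀ n : ℕ, ‖x‖ ≤ K * M * ‖x‖ * ((ρ + r) / 2) ^ n := by
    intro n
    have h1 : (2 : ℝ) ^ n * ‖x‖ ≤ K * M * (ρ + r) ^ n * ‖x‖ := by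
      calc (2 : ℝ) ^ n * ‖x‖ = ‖(v + w) ^ n * x‖ := by rw [hpow, norm_smul]; simp
        _ ≤ ‖(v + w) ^ n‖ * ‖x‖ := norm_mul_le _ _
        _ ≤ _ := by
          gcongr
          exact norm_add_pow_le_of_commute hvw hρ hv hw n
    rw [div_pow, mul_div_assoc', le_div_iff₀ (by positivity)]
    linarith
  have hlim : Tendsto (fun n : ℕ => K * M * ‖x‖ * ((ρ + r) / 2) ^ n) atTop (𝓝 (K * M * ‖x‖ * 0)) :=
    (tendsto_pow_atTop_nhds_zero_of_lt_one (by positivity) (by linarith)).const_mul _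
  have := ge_of_tendsto' hlim hb
  rw [mul_zero] at this
  exact norm_le_zero_iff.1 this

variable {𝔄 : Type*} [NonUnitalNormedRing 𝔄] [NormedSpace ℂ 𝔄] [IsScalarTower ℂ 𝔄 𝔄]
    [SMulCommClass ℂ 𝔄 𝔄] [CompleteSpace 𝔄]

/-- A quasi square root `v`, `1 - h = (1 - v) ^ 2`, which commutes with the commutant of `h`. -/
theorem exists_quasi_sqrt {h : 𝔄} (hn : ‖h‖ < 1) :
    ∃ v : 𝔄, ‖v‖ ≤ ‖h‖ ∧ (∀ w, Commute w h → Commute w v) ∧ v + v - v * v = h := by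
  -- A fixed point satisfies 2v - v² = h. The map is a contraction with constant ‖h‖ on the ball of
  -- radius ‖h‖, and it preserves the closed bicommutant condition.
  let F : 𝔄 → 𝔄 := fun v => (2⁻¹ : ℂ) • (h + v * v)
  let s : Set 𝔄 := Metric.closedBall 0 ‖h‖ ∩ {v | ∀ w, Commute w h → Commute w v}
  have hs : IsClosed s := by
    refine Metric.isClosed_closedBall.inter ?_
    simp only [Set.ofPred_forall]
    refine isClosed_iInter fun w => isClosed_iInter fun _ => ?_
    exact isClosed_eq (by fun_prop) (by fun_prop)
  have hF : Set.MapsTo F s s := by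
    rintro v ⟨hv, hvc⟩
    rw [mem_closedBall_zero_iff] at hv
    refine ⟨?_, fun w hw => ?_⟩
    · rw [mem_closedBall_zero_iff]
      calc ‖F v‖ = 2⁻¹ * ‖h + v * v‖ := by simp only [F, norm_smul]; simp
        _ ≤ 2⁻¹ * (‖h‖ + ‖v‖ * ‖v‖) := by
          gcongr
          exact (norm_add_le _ _).trans (by gcongr; exact norm_mul_le _ _)
        _ ≤ ‖h‖ := by nlinarith [norm_nonneg v, norm_nonneg h]
    · exact (hw.add_right ((hvc w hw).mul_right (hvc w hw))).smul_right _
  have hc : ContractingWith ‖h‖₊ (hF.restrict F s s) := by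
    refine ⟨by simpa [← NNReal.coe_lt_coe] using hn, LipschitzWith.of_dist_le_mul ?_⟩
    rintro ⟨v, hv, _⟩ ⟨w, hw, _⟩
    rw [mem_closedBall_zero_iff] at hv hw
    rw [Subtype.dist_eq, Subtype.dist_eq, dist_eq_norm, dist_eq_norm]
    change ‖F v - F w‖ ≤ ‖h‖ * ‖v - w‖
    have : F v - F w = (2⁻¹ : ℂ) • (v * (v - w) + (v - w) * w) := by
      simp only [F, ← smul_sub]
      congr 1
      noncomm_ring
    rw [this, norm_smul]
    calc ‖(2⁻¹ : ℂ)‖ * ‖v * (v - w) + (v - w) * w‖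
        ≤ 2⁻¹ * (‖v‖ * ‖v - w‖ + ‖v - w‖ * ‖w‖) := by
          rw [norm_inv, Complex.norm_ofNat]
          gcongr
          exact (norm_add_le _ _).trans (add_le_add (norm_mul_le _ _) (norm_mul_le _ _))
      _ ≤ 2⁻¹ * (‖h‖ * ‖v - w‖ + ‖v - w‖ * ‖h‖) := by gcongr
      _ = ‖h‖ * ‖v - w‖ := by ring
  have h0 : (0 : 𝔄) ∈ s := ⟨by simp, fun w _ => Commute.zero_right w⟩
  obtain ⟨v, ⟨hv, hvc⟩, hfix, -⟩ := hc.exists_fixedPoint' hs.isComplete hF h0 (edist_ne_top _ _)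
  refine ⟨v, by simpa using hv, hvc, ?_⟩
  have h2 : (2 : ℂ) • v = h + v * v := by
    conv_lhs => rw [← hfix.eq]
    simp [F, smul_smul]
  rw [← two_smul ℂ v, h2, add_sub_cancel_right]

variable [StarRing 𝔄] [StarModule ℂ 𝔄]

-- The spectrum is purely algebraic, so conjugation by the involution needs no continuity. This
-- controls the spectral radius of `star v` where its norm is out of reach.
omit [CompleteSpace 𝔄] in
theorem spectrum_toLp_inr_star (v : 𝔄) :
    spectrum ℂ (WithLp.toLp 1 ((star v : 𝔄) : Unitization ℂ 𝔄)) =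
      star (spectrum ℂ (WithLp.toLp 1 (v : Unitization ℂ 𝔄))) := by
  have h : ∀ x : WithLp 1 (Unitization ℂ 𝔄), spectrum ℂ x = spectrum ℂ (WithLp.ofLp x) := fun x =>
    (AlgEquiv.spectrum_eq (WithLp.unitizationAlgEquiv (𝕜 := ℂ) (A := 𝔄) ℂ) x).symm
  rw [h, h, Unitization.inr_star, spectrum.map_star]

/-- **Ford's square root lemma**, for an involution that need not be continuous. -/
theorem exists_selfAdjoint_quasi_sqrt {h : 𝔄} (hs : star h = h) (hn : ‖h‖ < 1) :
    ∃ v : 𝔄, star v = v ∧ v + v - v * v = h := by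
  obtain ⟨v, hv, hvc, hq⟩ := exists_quasi_sqrt hn
  refine ⟨v, ?_, hq⟩
  have hq' : star v + star v - star v * star v = h := by
    conv_rhs => rw [← hs, ← hq]
    simp
  -- `h` is a polynomial in `star v`, so `star v` commutes with `h`, and therefore with `v` by the
  -- bicommutant property.
  have hwh : Commute (star v) h := by
    rw [← hq']
    exact (((Commute.refl _).add_right (Commute.refl _)).sub_right
      ((Commute.refl _).mul_right (Commute.refl _)))
  have hcomm : Commute v (star v) := (hvc _ hwh).symm
  -- The ℓ¹ unitization is a unital Banach algebra containing 𝔄 isometrically, so spectral theory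
  -- applies there.
  let ι : 𝔄 → WithLp 1 (Unitization ℂ 𝔄) := fun a => WithLp.toLp 1 (a : Unitization ℂ 𝔄)
  have ι_mul : ∀ a b, ι (a * b) = ι a * ι b := fun a b => by
    apply WithLp.ofLp_injective
    simp [ι]
  have ι_add : ∀ a b, ι (a + b) = ι a + ι b := fun a b => by simp [ι]
  have ι_norm : ∀ a, ‖ι a‖ = ‖a‖ := WithLp.unitization_norm_inr
  obtain ⟨r, hr1, hr2⟩ := exists_between hn
  have hr0 : 0 < r := (norm_nonneg h).trans_lt hr1
  have norm_one_eq : ‖(1 : WithLp 1 (Unitization ℂ 𝔄))‖ = 1 := by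
    rw [WithLp.unitization_norm_def]
    have : (WithLp.ofLp (1 : WithLp 1 (Unitization ℂ 𝔄))) = 1 := rfl
    simp [this]
  have : NormOneClass (WithLp 1 (Unitization ℂ 𝔄)) := ⟨norm_one_eq⟩
  have hρ : spectralRadius ℂ (ι (star v)) < ENNReal.ofReal r := by
    refine lt_of_le_of_lt (b := ENNReal.ofReal ‖h‖) ?_ ((ENNReal.ofReal_lt_ofReal_iff hr0).2 hr1)
    refine iSup₂_le fun k hk => ?_
    have hk' : star k ∈ spectrum ℂ (ι v) := by
      have := spectrum_toLp_inr_star v ▸ hk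
      exact this
    have := spectrum.norm_le_norm_of_mem hk'
    rw [norm_star, ι_norm] at this
    rw [← enorm_eq_nnnorm, ← ofReal_norm]
    exact ENNReal.ofReal_le_ofReal (this.trans hv)
  obtain ⟨M, hM, hM'⟩ := exists_norm_pow_le_of_spectralRadius_lt hr0 hρ
  have hV : ∀ n : ℕ, ‖ι v ^ n‖ ≤ 1 * ‖h‖ ^ n := fun n => by
    rw [one_mul]
    refine (norm_pow_le _ _).trans ?_
    rw [ι_norm]
    gcongr
  have hx : (ι v + ι (star v)) * ι (v - star v) = (2 : ℂ) • ι (v - star v) := by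
    rw [← ι_add, ← ι_mul, two_smul, ← ι_add]
    congr 1
    have e : (v + star v) * (v - star v) = v * v - star v * star v + (star v * v - v * star v) := by
      noncomm_ring
    rw [e, hcomm.eq, sub_self, add_zero]
    have e1 : v * v = v + v - h := by rw [← hq]; abel
    have e2 : star v * star v = star v + star v - h := by
      rw [← hq']; abel
    rw [e1, e2]
    abel
  have hιc : Commute (ι v) (ι (star v)) := by
    rw [Commute, SemiconjBy, ← ι_mul, ← ι_mul, hcomm.eq]
  have h0 := eq_zero_of_add_mul_eq_two_smul hιc (norm_nonneg h) hr0.le hV hM' (by linarith) hx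
  have := ι_norm (v - star v)
  rw [h0, norm_zero, eq_comm, norm_eq_zero, sub_eq_zero] at this
  exact this.symm

end SquareRoot


/-! ### Bounds for left multiplication on the classes -/

section Bounds

variable {𝔄 : Type*} [NonUnitalNormedRing 𝔄] [NormedSpace ℂ 𝔄] [IsScalarTower ℂ 𝔄 𝔄]
    [SMulCommClass ℂ 𝔄 𝔄] [CompleteSpace 𝔄] [StarRing 𝔄] [StarModule ℂ 𝔄]

/-- With 1 - h = (1 - v)² and v self-adjoint, d*d - d*hd equals (d - vd)*(d - vd), on which f is
nonnegative. -/
theorem IsPosFunctional.re_conj_le_of_norm_lt_one {f : 𝔄 →ₗ[ℂ] ℂ} (hf : IsPosFunctional f)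
    {h : 𝔄} (hs : star h = h) (hn : ‖h‖ < 1) (d : 𝔄) :
    (f (star d * h * d)).re ≤ (f (star d * d)).re := by
  obtain ⟨v, hv, rfl⟩ := exists_selfAdjoint_quasi_sqrt hs hn
  have h1 := (Complex.nonneg_iff.1 (hf (d - v * d))).1
  have e : star (d - v * d) * (d - v * d) = star d * d - star d * (v + v - v * v) * d := by
    rw [star_sub, star_mul, hv]
    noncomm_ring
  rw [e, map_sub, Complex.sub_re] at h1
  linarith

theorem IsPosFunctional.re_conj_le {f : 𝔄 →ₗ[ℂ] ℂ} (hf : IsPosFunctional f)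
    {h : 𝔄} (hs : star h = h) (d : 𝔄) :
    (f (star d * h * d)).re ≤ ‖h‖ * (f (star d * d)).re := by
  have key : ∀ c : ℝ, ‖h‖ < c → (f (star d * h * d)).re ≤ c * (f (star d * d)).re := by
    intro c hc
    have hc0 : 0 < c := (norm_nonneg h).trans_lt hc
    have h1 := hf.re_conj_le_of_norm_lt_one (h := ((c⁻¹ : ℝ) : ℂ) • h) (d := d)
      (by rw [star_smul, hs]; simp) (by
        rw [norm_smul, Complex.norm_real, Real.norm_of_nonneg (by positivity),
          inv_mul_lt_iff₀ hc0, mul_one]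
        exact hc)
    rw [mul_smul_comm, smul_mul_assoc, map_smul, smul_eq_mul, Complex.re_ofReal_mul,
      inv_mul_le_iff₀ hc0] at h1
    exact h1
  have hlim : Tendsto (fun c : ℝ => c * (f (star d * d)).re) (𝓝[>] ‖h‖)
      (𝓝 (‖h‖ * (f (star d * d)).re)) :=
    (tendsto_id.mono_left nhdsWithin_le_nhds).mul_const _
  exact ge_of_tendsto hlim (by filter_upwards [self_mem_nhdsWithin] with c hc using key c hc)

theorem norm_sq_cls_mul_le {f : 𝔄 →ₗ[ℂ] ℂ} (hf : IsPosFunctional f) (a d : 𝔄) :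
    ‖cls (functionalForm f hf) (a * d)‖ ^ 2 ≤
      ‖star a * a‖ * ‖cls (functionalForm f hf) d‖ ^ 2 := by
  rw [cls_norm_sq, cls_norm_sq]
  have := hf.re_conj_le (h := star a * a) (by simp) d
  change (f (star (a * d) * (a * d))).re ≤ _
  rw [star_mul, show star d * star a * (a * d) = star d * (star a * a) * d by noncomm_ring]
  exact this

variable (𝔄) in
omit [IsScalarTower ℂ 𝔄 𝔄] [SMulCommClass ℂ 𝔄 𝔄] in
/-- A seminorm `p` with `p a ^ 2 ≤ ‖a* a‖ D ^ 2` is bounded by a fixed multiple of `D ‖a‖`, even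
if the involution is discontinuous. -/
theorem exists_seminorm_bound_of_sq_le :
    ∃ K : ℝ, 0 ≤ K ∧ ∀ (p : Seminorm ℂ 𝔄) (D : ℝ), 0 ≤ D →
      (∀ a, p a ^ 2 ≤ ‖star a * a‖ * D ^ 2) → ∀ a, p a ≤ K * ‖a‖ * D := by
  -- The graph of the involution, linear only over ℝ. Its closure is a Banach space mapping onto 𝔄
  -- by the first coordinate, so the open mapping theorem supplies pairs (a, y) in it with ‖y‖ ≤
  -- C‖a‖, even if y ≠ a*.
  let S : Submodule ℝ (𝔄 × 𝔄) :=
    { carrier := Set.range fun a : 𝔄 => (a, star a)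
      zero_mem' := ⟨0, by simp⟩
      add_mem' := by
        rintro _ _ ⟨a, rfl⟩ ⟨b, rfl⟩
        exact ⟨a + b, by simp⟩
      smul_mem' := by
        rintro c _ ⟨a, rfl⟩
        refine ⟨(c : ℂ) • a, ?_⟩
        simp [star_smul] }
  let G := S.topologicalClosure
  have : CompleteSpace G := S.isClosed_topologicalClosure.completeSpace_coe
  let T : G →L[ℝ] 𝔄 := (ContinuousLinearMap.fst ℝ 𝔄 𝔄).comp G.subtypeL
  have hT : Function.Surjective T := fun a =>
    ⟨⟨(a, star a), S.le_topologicalClosure ⟨a, rfl⟩⟩, rfl⟩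
  obtain ⟨C, hC, hC'⟩ := T.exists_preimage_norm_le hT
  refine ⟨Real.sqrt C, Real.sqrt_nonneg _, fun p D hD hp a => ?_⟩
  obtain ⟨⟨⟨a', y⟩, hy⟩, rfl, hay⟩ := hC' a
  change p a' ≤ Real.sqrt C * ‖a'‖ * D
  replace hay : ‖y‖ ≤ C * ‖a'‖ := (norm_snd_le (a', y)).trans hay
  obtain ⟨u, hu, hlim⟩ := mem_closure_iff_seq_limit.1
    (show (a', y) ∈ closure (S : Set (𝔄 × 𝔄)) from hy)
  choose x hx using hu
  have h1 : Tendsto x atTop (𝓝 a') := by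
    have := (continuous_fst.tendsto _).comp hlim
    exact this.congr fun n => by simp [← hx]
  have h2 : Tendsto (fun n => star (x n)) atTop (𝓝 y) := by
    have := (continuous_snd.tendsto _).comp hlim
    exact this.congr fun n => by simp [← hx]
  have h3 : Tendsto (fun n => x n - a') atTop (𝓝 0) := by
    simpa using h1.sub_const a'
  have h4 : Tendsto (fun n => star (x n - a')) atTop (𝓝 (y - star a')) := by
    simpa using h2.sub_const (star a')
  -- In (x n - a')*(x n - a') the right factor tends to 0 and the left one converges, though perhaps
  -- not to 0; this suffices for p(x n) → p(a').
  have h5 : Tendsto (fun n => p (x n - a')) atTop (𝓝 0) := by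
    have h6 : Tendsto (fun n => Real.sqrt (‖star (x n - a') * (x n - a')‖ * D ^ 2)) atTop (𝓝 0) := by
      have := ((h4.mul h3).norm.mul_const (D ^ 2)).sqrt
      simpa using this
    exact squeeze_zero (fun n => apply_nonneg p _) (fun n => Real.le_sqrt_of_sq_le (hp _)) h6
  have h7 : Tendsto (fun n => p (x n)) atTop (𝓝 (p a')) := by
    rw [tendsto_iff_norm_sub_tendsto_zero]
    exact squeeze_zero (fun n => norm_nonneg _) (fun n => p.norm_sub_map_le_sub _ _) h5
  have h8 : p a' ^ 2 ≤ ‖y * a'‖ * D ^ 2 :=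
    le_of_tendsto_of_tendsto' (h7.pow 2) ((h2.mul h1).norm.mul_const _) fun n => hp _
  refine le_of_sq_le_sq ?_ (by positivity)
  calc p a' ^ 2 ≤ ‖y * a'‖ * D ^ 2 := h8
    _ ≤ (C * ‖a'‖ * ‖a'‖) * D ^ 2 := by
      gcongr
      exact (norm_mul_le _ _).trans (by gcongr)
    _ = _ := by rw [mul_pow, mul_pow, Real.sq_sqrt hC.le]; ring

-- The seminorm bound is applied to a ↦ ‖[ad]‖ with D = ‖[d]‖; the constant depends on 𝔄 alone.
variable (𝔄) in
theorem exists_norm_cls_mul_le : ∃ K : ℝ, 0 ≤ K ∧ ∀ (f : 𝔄 →ₗ[ℂ] ℂ) (hf : IsPosFunctional f)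
    (a d : 𝔄), ‖cls (functionalForm f hf) (a * d)‖ ≤
      K * ‖a‖ * ‖cls (functionalForm f hf) d‖ := by
  obtain ⟨K, hK, h⟩ := exists_seminorm_bound_of_sq_le 𝔄
  refine ⟨K, hK, fun f hf a d => ?_⟩
  exact h ((normSeminorm ℂ _).comp (cls (functionalForm f hf) ∘ₗ LinearMap.mulRight ℂ d)) _
    (norm_nonneg _) (fun b => norm_sq_cls_mul_le hf b d) a

end Bounds


/-! ### Cohen factorization for Banach modules -/

section Cohen

variable {𝔄 : Type*} [NonUnitalNormedRing 𝔄] [NormedSpace ℂ 𝔄]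
  {X : Type*} [NormedAddCommGroup X] [NormedSpace ℂ X] [CompleteSpace X]

/-- If `‖S‖ ≤ N` and `γ = (N + 2)⁻¹`, then `(1 - γ) + γ S` is invertible and expands norms by `γ`
at least. -/
theorem exists_unit_convex_combination {S : X →L[ℂ] X} {N γ : ℝ} (hN : 0 ≤ N)
    (hγ : γ = (N + 2)⁻¹) (hS : ‖S‖ ≤ N) :
    ∃ U : (X →L[ℂ] X)ˣ, (U : X →L[ℂ] X) = ((1 - γ : ℝ) : ℂ) • 1 + (γ : ℂ) • S ∧
      ‖((U⁻¹ : (X →L[ℂ] X)ˣ) : X →L[ℂ] X)‖ ≤ γ⁻¹ := by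
  have hγ0 : 0 < γ := by rw [hγ]; positivity
  have hγN : γ * (N + 2) = 1 := by rw [hγ]; field_simp
  have hγ1 : 0 < 1 - γ := by nlinarith
  -- Neumann series: γN/(1 - γ) = N/(N + 1). The bound on the inverse comes from 1 - γ - γN = γ.
  have hlt : ‖-((γ / (1 - γ) : ℝ) : ℂ) • S‖ < 1 := by
    rw [norm_smul, norm_neg, Complex.norm_real, Real.norm_of_nonneg (by positivity)]
    calc γ / (1 - γ) * ‖S‖ ≤ γ / (1 - γ) * N := by gcongr
      _ < 1 := by rw [div_mul_eq_mul_div, div_lt_one hγ1]; nlinarith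
  have hunit : IsUnit (((1 - γ : ℝ) : ℂ) • (1 : X →L[ℂ] X) + (γ : ℂ) • S) := by
    have h1 : ((1 - γ : ℝ) : ℂ) ≠ 0 := by exact_mod_cast hγ1.ne'
    have h2 := ((Units.oneSub _ hlt).isUnit).smul (Units.mk0 _ h1)
    convert h2 using 1
    rw [Units.val_oneSub, Units.smul_mk0, smul_sub, neg_smul, smul_neg, sub_neg_eq_add, smul_smul,
      Complex.ofReal_div, mul_div_cancel₀ _ h1]
  obtain ⟨U, hU⟩ := hunit
  refine ⟨U, hU, ContinuousLinearMap.opNorm_le_bound _ (by positivity) fun z => ?_⟩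
  set w := ((U⁻¹ : (X →L[ℂ] X)ˣ) : X →L[ℂ] X) z with hw
  have hz : z = ((1 - γ : ℝ) : ℂ) • w + (γ : ℂ) • S w := by
    have : (U : X →L[ℂ] X) w = z := by
      rw [hw, ← mul_apply_eq_comp, Units.mul_inv]; rfl
    rw [← this, hU]; rfl
  rw [le_inv_mul_iff₀ hγ0]
  have h3 : ‖((1 - γ : ℝ) : ℂ) • w‖ = (1 - γ) * ‖w‖ := by
    rw [norm_smul, Complex.norm_real, Real.norm_of_nonneg hγ1.le]
  have h4 : ‖(γ : ℂ) • S w‖ ≤ γ * (N * ‖w‖) := by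
    rw [norm_smul, Complex.norm_real, Real.norm_of_nonneg hγ0.le]
    gcongr
    exact S.le_of_opNorm_le hS w
  have h5 : ‖((1 - γ : ℝ) : ℂ) • w‖ ≤ ‖z‖ + ‖(γ : ℂ) • S w‖ := by
    conv_lhs => rw [show ((1 - γ : ℝ) : ℂ) • w = z - (γ : ℂ) • S w by rw [hz]; abel]
    exact norm_sub_le _ _
  nlinarith [norm_nonneg w]

variable {L : 𝔄 →L[ℂ] X →L[ℂ] X} {I : Type*} {l : Filter I} [l.NeBot] {e : I → 𝔄} {M : ℝ}

/-- The inductive step in the proof of Cohen's factorization theorem. -/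
theorem cohen_step (hL : ∀ a b, L (a * b) = L a * L b)
    (hM : ∀ i, ‖e i‖ ≤ M) (he : ∀ a, Tendsto (fun i => e i * a) l (𝓝 a))
    (hx : ∀ x, Tendsto (fun i => L (e i) x) l (𝓝 x)) {γ τ : ℝ} (hγ : γ = (‖L‖ * M + 2)⁻¹)
    {c : 𝔄} {x y : X} (hT : IsUnit ((τ : ℂ) • 1 + L c)) (hy : ((τ : ℂ) • 1 + L c) y = x)
    {ε : ℝ} (hε : 0 < ε) :
    ∃ i y', IsUnit (((τ * (1 - γ) : ℝ) : ℂ) • 1 + L (c + ((τ * γ : ℝ) : ℂ) • e i)) ∧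
      (((τ * (1 - γ) : ℝ) : ℂ) • 1 + L (c + ((τ * γ : ℝ) : ℂ) • e i)) y' = x ∧ ‖y' - y‖ < ε := by
  obtain ⟨i₀⟩ := l.nonempty_of_neBot
  have hM0 : 0 ≤ M := (norm_nonneg _).trans (hM i₀)
  have hLe : ∀ i, ‖L (e i)‖ ≤ ‖L‖ * M := fun i => (L.le_opNorm _).trans (by gcongr; exact hM i)
  have hγ0 : 0 < γ := by rw [hγ]; positivity
  choose U hU hUinv using fun i => exists_unit_convex_combination (by positivity) hγ (hLe i)
  let V : I → X →L[ℂ] X := fun i => ((U i)⁻¹ : (X →L[ℂ] X)ˣ)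
  have hVU : ∀ i, V i * (U i : X →L[ℂ] X) = 1 := fun i => Units.inv_mul _
  have hUV : ∀ i, (U i : X →L[ℂ] X) * V i = 1 := fun i => Units.mul_inv _
  -- `V i` need not tend to 1 in norm. By this identity it does so after multiplication by `L c`,
  -- and pointwise at `x`.
  have hdiff : ∀ i, V i - 1 = (γ : ℂ) • (V i * (1 - L (e i))) := fun i => by
    have : 1 - (U i : X →L[ℂ] X) = (γ : ℂ) • (1 - L (e i)) := by
      rw [hU, Complex.ofReal_sub, Complex.ofReal_one, sub_smul, one_smul, smul_sub]
      abel
    rw [← mul_smul_comm, ← this, mul_sub, mul_one, hVU]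
  have hγV : ∀ i, ‖(γ : ℂ)‖ * ‖V i‖ ≤ 1 := fun i => by
    rw [Complex.norm_real, Real.norm_of_nonneg hγ0.le]
    calc γ * ‖V i‖ ≤ γ * γ⁻¹ := by gcongr; exact hUinv i
      _ = 1 := mul_inv_cancel₀ hγ0.ne'
  have hV1 : Tendsto (fun i => V i * L c) l (𝓝 (L c)) := by
    rw [tendsto_iff_norm_sub_tendsto_zero]
    have h0 : Tendsto (fun i => ‖L (c - e i * c)‖) l (𝓝 0) := by
      have := ((L.continuous.tendsto _).comp ((he c).const_sub c)).norm
      simpa using this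
    refine squeeze_zero (fun i => norm_nonneg _) (fun i => ?_) h0
    have : V i * L c - L c = (γ : ℂ) • (V i * L (c - e i * c)) := by
      calc V i * L c - L c = (V i - 1) * L c := by rw [sub_mul, one_mul]
        _ = _ := by rw [hdiff, smul_mul_assoc, mul_assoc, sub_mul, one_mul, map_sub, hL]
    rw [this]
    calc ‖(γ : ℂ) • (V i * L (c - e i * c))‖ ≤ ‖(γ : ℂ)‖ * (‖V i‖ * ‖L (c - e i * c)‖) := by
          rw [norm_smul]; gcongr; exact norm_mul_le _ _
      _ = (‖(γ : ℂ)‖ * ‖V i‖) * ‖L (c - e i * c)‖ := by ring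
      _ ≤ 1 * ‖L (c - e i * c)‖ := by gcongr; exact hγV i
      _ = _ := one_mul _
  have hV2 : Tendsto (fun i => V i x) l (𝓝 x) := by
    rw [tendsto_iff_norm_sub_tendsto_zero]
    have h0 : Tendsto (fun i => ‖x - L (e i) x‖) l (𝓝 0) := by
      simpa using ((hx x).const_sub x).norm
    refine squeeze_zero (fun i => norm_nonneg _) (fun i => ?_) h0
    have : V i x - x = (γ : ℂ) • V i (x - L (e i) x) := congrArg (fun S : X →L[ℂ] X => S x) (hdiff i)
    rw [this]
    calc ‖(γ : ℂ) • V i (x - L (e i) x)‖ ≤ ‖(γ : ℂ)‖ * (‖V i‖ * ‖x - L (e i) x‖) := by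
          rw [norm_smul]; gcongr; exact (V i).le_opNorm _
      _ = (‖(γ : ℂ)‖ * ‖V i‖) * ‖x - L (e i) x‖ := by ring
      _ ≤ 1 * ‖x - L (e i) x‖ := by gcongr; exact hγV i
      _ = _ := one_mul _
  let T : X →L[ℂ] X := (τ : ℂ) • 1 + L c
  let S : I → X →L[ℂ] X := fun i => (τ : ℂ) • 1 + V i * L c
  have hS : Tendsto S l (𝓝 T) := hV1.const_add _
  have hSu : ∀ᶠ i in l, IsUnit (S i) := hS.eventually (Units.isOpen.mem_nhds hT)
  obtain ⟨u, hu⟩ := hT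
  have hinv : Tendsto (fun i => Ring.inverse (S i)) l (𝓝 (Ring.inverse T)) := by
    have := NormedRing.inverse_continuousAt u
    rw [hu] at this
    exact this.tendsto.comp hS
  have hlim : Tendsto (fun i => Ring.inverse (S i) (V i x)) l (𝓝 (Ring.inverse T x)) := by
    have hc : Continuous fun q : (X →L[ℂ] X) × X => q.1 q.2 := by fun_prop
    exact (hc.tendsto (Ring.inverse T, x)).comp (hinv.prodMk_nhds hV2)
  have hTy : Ring.inverse T x = y := by
    rw [← hy]
    change (Ring.inverse T * T) y = y
    rw [Ring.inverse_mul_cancel T ⟨u, hu⟩]; rfl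
  rw [hTy] at hlim
  obtain ⟨i, hi1, hi2⟩ := (hSu.and ((Metric.tendsto_nhds.1 hlim) ε hε)).exists
  -- The new operator factors through `S i`, which is close to the old invertible operator `T`. So
  -- the new solution (S i)⁻¹(V i x) is close to y = T⁻¹x.
  have hfac : ((τ * (1 - γ) : ℝ) : ℂ) • 1 + L (c + ((τ * γ : ℝ) : ℂ) • e i) =
      (U i : X →L[ℂ] X) * S i := by
    rw [mul_add, mul_smul_comm, mul_one, ← mul_assoc, hUV, one_mul, hU, map_add, map_smul,
      Complex.ofReal_mul, Complex.ofReal_mul, smul_add, smul_smul, smul_smul]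
    abel
  refine ⟨i, Ring.inverse (S i) (V i x), ?_, ?_, by rwa [← dist_eq_norm]⟩
  · rw [hfac]; exact (U i).isUnit.mul hi1
  · rw [hfac]
    change ((U i : X →L[ℂ] X) * (S i * Ring.inverse (S i)) * V i) x = x
    rw [Ring.mul_inverse_cancel _ hi1, mul_one, hUV]; rfl

/-- **Cohen's factorization theorem** for a Banach module. -/
theorem cohen_factorization [CompleteSpace 𝔄] (hL : ∀ a b, L (a * b) = L a * L b)
    (hM : ∀ i, ‖e i‖ ≤ M) (he : ∀ a, Tendsto (fun i => e i * a) l (𝓝 a))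
    (hx : ∀ x, Tendsto (fun i => L (e i) x) l (𝓝 x)) (x : X) : ∃ c y, L c y = x := by
  obtain ⟨i₀⟩ := l.nonempty_of_neBot
  have hM0 : 0 ≤ M := (norm_nonneg _).trans (hM i₀)
  obtain ⟨γ, hγ⟩ : ∃ γ : ℝ, γ = (‖L‖ * M + 2)⁻¹ := ⟨_, rfl⟩
  have hγ0 : 0 < γ := by rw [hγ]; positivity
  have hγ1 : γ < 1 := by rw [hγ]; exact inv_lt_one_of_one_lt₀ (by linarith [mul_nonneg (norm_nonneg L) hM0])
  -- The scalar part (1 - γ)ⁿ tends to 0, so the equation becomes L c y = x in the limit. The start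
  -- (0, x) has scalar part 1.
  let Q : ℕ → 𝔄 × X → Prop := fun n q => IsUnit ((((1 - γ) ^ n : ℝ) : ℂ) • 1 + L q.1) ∧
    ((((1 - γ) ^ n : ℝ) : ℂ) • 1 + L q.1) q.2 = x
  have step : ∀ n q, Q n q → ∃ q' : 𝔄 × X, Q (n + 1) q' ∧ ‖q.1 - q'.1‖ ≤ γ * M * (1 - γ) ^ n ∧
      ‖q.2 - q'.2‖ ≤ 1 * (1 / 2) ^ n := by
    rintro n ⟨c, y⟩ ⟨h1, h2⟩
    obtain ⟨i, y', h3, h4, h5⟩ := cohen_step hL hM he hx hγ h1 h2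
      (show (0 : ℝ) < 1 * (1 / 2) ^ n by positivity)
    refine ⟨(c + (((1 - γ) ^ n * γ : ℝ) : ℂ) • e i, y'), ⟨?_, ?_⟩, ?_, ?_⟩
    · rw [pow_succ]; exact h3
    · rw [pow_succ]; exact h4
    · have h0 : 0 ≤ (1 - γ) ^ n * γ := mul_nonneg (pow_nonneg (by linarith) n) hγ0.le
      rw [sub_add_cancel_left, norm_neg, norm_smul, Complex.norm_real, Real.norm_of_nonneg h0]
      calc (1 - γ) ^ n * γ * ‖e i‖ ≤ (1 - γ) ^ n * γ * M := by gcongr; exact hM i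
        _ = _ := by ring
    · rw [norm_sub_rev]; exact h5.le
  choose! F hF hF1 hF2 using step
  let s : ℕ → 𝔄 × X := fun n => Nat.rec (0, x) F n
  have hs : ∀ n, Q n (s n) := by
    intro n
    induction n with
    | zero => simp [s, Q]
    | succ n ih => exact hF n _ ih
  have hc1 : CauchySeq fun n => (s n).1 :=
    cauchySeq_of_le_geometric (1 - γ) (γ * M) (by linarith) fun n => by
      rw [dist_eq_norm]; exact hF1 n _ (hs n)
  have hc2 : CauchySeq fun n => (s n).2 :=
    cauchySeq_of_le_geometric (1 / 2) 1 (by norm_num) fun n => by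
      rw [dist_eq_norm]; exact hF2 n _ (hs n)
  obtain ⟨c, hc⟩ := cauchySeq_tendsto_of_complete hc1
  obtain ⟨y, hy⟩ := cauchySeq_tendsto_of_complete hc2
  refine ⟨c, y, ?_⟩
  have hp : Tendsto (fun n : ℕ => (((1 - γ) ^ n : ℝ) : ℂ)) atTop (𝓝 ((0 : ℝ) : ℂ)) :=
    (Complex.continuous_ofReal.tendsto _).comp
      (tendsto_pow_atTop_nhds_zero_of_lt_one (by linarith) (by linarith))
  have hlim : Tendsto (fun n => (((1 - γ) ^ n : ℝ) : ℂ) • (s n).2 + L (s n).1 (s n).2) atTop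
      (𝓝 (((0 : ℝ) : ℂ) • y + L c y)) := by
    have hcont : Continuous fun q : 𝔄 × X => L q.1 q.2 := by fun_prop
    exact (hp.smul hy).add ((hcont.tendsto (c, y)).comp (hc.prodMk_nhds hy))
  have hconst : ∀ n, (((1 - γ) ^ n : ℝ) : ℂ) • (s n).2 + L (s n).1 (s n).2 = x := fun n => (hs n).2
  simp only [hconst, Complex.ofReal_zero, zero_smul, zero_add] at hlim
  exact tendsto_nhds_unique hlim tendsto_const_nhds

end Cohen


/-! ### Common factors of summable sequences and automatic continuity -/

section Factorization

open scoped ENNReal lp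

variable {𝔄 : Type*} [NonUnitalNormedRing 𝔄]

theorem norm_eq_tsum_lp_one (x : lp (fun _ : ℕ => 𝔄) 1) : ‖x‖ = ∑' n, ‖x n‖ := by
  rw [lp.norm_eq_tsum_rpow (by simp)]
  simp

theorem memℓp_one_iff {x : ℕ → 𝔄} : Memℓp (E := fun _ => 𝔄) x 1 ↔ Summable fun n => ‖x n‖ := by
  rw [memℓp_gen_iff (by simp)]
  simp

theorem summable_norm_lp_one (x : lp (fun _ : ℕ => 𝔄) 1) : Summable fun n => ‖x n‖ :=
  memℓp_one_iff.1 x.2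

theorem summable_norm_const_mul (c : 𝔄) {x : ℕ → 𝔄} (hx : Summable fun n => ‖x n‖) :
    Summable fun n => ‖c * x n‖ :=
  (hx.mul_left ‖c‖).of_nonneg_of_le (fun _ => norm_nonneg _) fun _ => norm_mul_le _ _

variable [NormedSpace ℂ 𝔄] [IsScalarTower ℂ 𝔄 𝔄] [SMulCommClass ℂ 𝔄 𝔄]

variable (𝔄) in
/-- The left regular action of `𝔄` on `ℓ¹(ℕ, 𝔄)`. -/
noncomputable def lpOneMul :
    𝔄 →L[ℂ] lp (fun _ : ℕ => 𝔄) 1 →L[ℂ] lp (fun _ : ℕ => 𝔄) 1 :=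
  LinearMap.mkContinuous₂
    (LinearMap.mk₂ ℂ (fun c x => ⟨fun n => c * x n,
        memℓp_one_iff.2 (summable_norm_const_mul c (summable_norm_lp_one x))⟩)
      (fun c d x => lp.ext (funext fun n => add_mul c d (x n)))
      (fun r c x => lp.ext (funext fun n => smul_mul_assoc r c (x n)))
      (fun c x y => lp.ext (funext fun n => mul_add c (x n) (y n)))
      (fun r c x => lp.ext (funext fun n => mul_smul_comm r c (x n)))) 1
    fun c x => by
      rw [norm_eq_tsum_lp_one, norm_eq_tsum_lp_one, one_mul, ← tsum_mul_left]
      exact (summable_norm_const_mul c (summable_norm_lp_one x)).tsum_le_tsum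
        (fun n => norm_mul_le c (x n)) ((summable_norm_lp_one x).mul_left _)

variable {I : Type*} {l : Filter I} {e : I → 𝔄} {M : ℝ}

/-- Dominated convergence for series: each coordinate converges, with dominating sequence (M + 1)‖x
n‖. -/
theorem tendsto_lpOneMul (hM : ∀ i, ‖e i‖ ≤ M) (he : ∀ a, Tendsto (fun i => e i * a) l (𝓝 a))
    (x : lp (fun _ : ℕ => 𝔄) 1) : Tendsto (fun i => lpOneMul 𝔄 (e i) x) l (𝓝 x) := by
  rw [tendsto_iff_norm_sub_tendsto_zero]
  simp only [norm_eq_tsum_lp_one]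
  have h := tendsto_tsum_of_dominated_convergence (𝓕 := l)
    (f := fun i n => ‖(lpOneMul 𝔄 (e i) x - x) n‖) (g := fun _ : ℕ => (0 : ℝ))
    (bound := fun n => (M + 1) * ‖x n‖) ((summable_norm_lp_one x).mul_left _)
    (fun n => tendsto_iff_norm_sub_tendsto_zero.1 (he (x n)))
    (Eventually.of_forall fun i n => by
      rw [norm_norm]
      calc ‖e i * x n - x n‖ ≤ ‖e i * x n‖ + ‖x n‖ := norm_sub_le _ _
        _ ≤ M * ‖x n‖ + ‖x n‖ := by
          gcongr
          exact (norm_mul_le _ _).trans (by gcongr; exact hM i)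
        _ = _ := by ring)
  simpa using h

variable [CompleteSpace 𝔄] [l.NeBot]

/-- Summable sequences have a common left factor. -/
theorem exists_common_left_factor (hM : ∀ i, ‖e i‖ ≤ M)
    (he : ∀ a, Tendsto (fun i => e i * a) l (𝓝 a)) {a : ℕ → 𝔄} (ha : Summable fun n => ‖a n‖) :
    ∃ (c : 𝔄) (b : ℕ → 𝔄), (∀ n, c * b n = a n) ∧ Summable fun n => ‖b n‖ := by
  obtain ⟨c, y, h⟩ := cohen_factorization (L := lpOneMul 𝔄) (l := l)
    (fun a b => by ext x n; exact mul_assoc a b (x n)) hM he (tendsto_lpOneMul hM he)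
    (⟨a, memℓp_one_iff.2 ha⟩ : lp (fun _ : ℕ => 𝔄) 1)
  exact ⟨c, y, fun n => congrArg (fun z : lp (fun _ : ℕ => 𝔄) 1 => z n) h, summable_norm_lp_one y⟩

theorem exists_eq_mul (hM : ∀ i, ‖e i‖ ≤ M) (he : ∀ a, Tendsto (fun i => e i * a) l (𝓝 a))
    (a : 𝔄) : ∃ c b, c * b = a := by
  obtain ⟨c, b, h, -⟩ := exists_common_left_factor (a := Pi.single 0 a) hM he
    (summable_of_ne_finset_zero (s := {0}) fun n hn => by
      rw [Pi.single_eq_of_ne (by simpa using hn), norm_zero])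
  exact ⟨c, b 0, by simpa using h 0⟩

/-- A functional is continuous if it is so after multiplication by each element from the left. -/
theorem continuous_of_continuous_const_mul (hM : ∀ i, ‖e i‖ ≤ M)
    (he : ∀ a, Tendsto (fun i => e i * a) l (𝓝 a)) (φ : 𝔄 →ₗ[ℂ] ℂ)
    (hφ : ∀ c, Continuous fun a => φ (c * a)) : Continuous φ := by
  by_contra hcon
  have hunb : ∀ n : ℕ, ∃ a : 𝔄, ‖a‖ = (1 / 2) ^ n ∧ 1 ≤ ‖φ a‖ := by
    intro n
    by_contra! hn
    refine hcon (AddMonoidHomClass.continuous_of_bound φ (2 ^ n) fun a => ?_)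
    rcases eq_or_ne a 0 with rfl | ha
    · simp
    have ha' : 0 < ‖a‖ := norm_pos_iff.2 ha
    have h1 := hn ((((2 : ℝ) ^ n * ‖a‖)⁻¹ : ℝ) • (a : 𝔄)) (by
      rw [norm_smul, norm_inv, norm_mul, norm_norm, norm_pow, Real.norm_ofNat, one_div, inv_pow]
      field_simp)
    rw [← Complex.coe_smul, map_smul, norm_smul, Complex.norm_real,
      Real.norm_of_nonneg (by positivity), inv_mul_lt_iff₀ (by positivity), mul_one] at h1
    exact h1.le
  choose a ha ha' using hunb
  -- Discontinuity gave a summable sequence with |φ(a n)| ≥ 1. Writing a n = c b n with b n → 0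
  -- contradicts the continuity of φ(c ·).
  obtain ⟨c, b, hb, hbs⟩ := exists_common_left_factor hM he (a := a) (by
    simp only [ha]; exact summable_geometric_of_lt_one (by norm_num) (by norm_num))
  have hb0 : Tendsto b atTop (𝓝 0) := tendsto_zero_iff_norm_tendsto_zero.2 hbs.tendsto_atTop_zero
  have hlim := (((hφ c).tendsto 0).comp hb0).norm
  simp only [Function.comp_apply, hb, mul_zero, map_zero, norm_zero] at hlim
  exact absurd (ge_of_tendsto' hlim ha') (by norm_num)

/-- The left-sided version in the opposite algebra. -/
theorem continuous_of_continuous_mul_const (hM : ∀ i, ‖e i‖ ≤ M)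
    (he : ∀ a, Tendsto (fun i => a * e i) l (𝓝 a)) (φ : 𝔄 →ₗ[ℂ] ℂ)
    (hφ : ∀ c, Continuous fun a => φ (a * c)) : Continuous φ := by
  have h := continuous_of_continuous_const_mul (𝔄 := 𝔄ᵐᵒᵖ) (e := fun i => MulOpposite.op (e i))
    (l := l) (M := M) (fun i => hM i)
    (fun a => (MulOpposite.continuous_op.tendsto _).comp (he a.unop))
    (φ ∘ₗ (MulOpposite.opLinearEquiv ℂ).symm.toLinearMap)
    (fun c => (hφ c.unop).comp MulOpposite.continuous_unop)
  exact h.comp MulOpposite.continuous_op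

end Factorization

/-! ### Continuity and representability of positive functionals -/

section Representability

variable {𝔄 : Type*} [NonUnitalNormedRing 𝔄] [NormedSpace ℂ 𝔄] [IsScalarTower ℂ 𝔄 𝔄]
    [SMulCommClass ℂ 𝔄 𝔄] [CompleteSpace 𝔄] [StarRing 𝔄] [StarModule ℂ 𝔄]
    {I : Type*} [Preorder I] [IsDirectedOrder I] [Nonempty I] {e : I → 𝔄}
    {f : 𝔄 →ₗ[ℂ] ℂ}

omit [CompleteSpace 𝔄] in
theorem functionalForm_apply (hf : IsPosFunctional f) (a b : 𝔄) :
    (functionalForm f hf).toMap a b = f (star b * a) := rfl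

/-- Varopoulos: positive functionals are continuous if there is a bounded approximate unit. -/
theorem IsPosFunctional.continuous (hf : IsPosFunctional f) (he : IsApproxUnit e) :
    Continuous f := by
  obtain ⟨M, hM⟩ := he.bounded
  obtain ⟨K, hK, hKb⟩ := exists_norm_cls_mul_le 𝔄
  -- It remains to bound f(cad) = ([ad] | [c*]) in a, once the right factor d is also inserted.
  refine continuous_of_continuous_const_mul hM he.tendsto_left f fun c => ?_
  refine continuous_of_continuous_mul_const hM he.tendsto_right (f ∘ₗ LinearMap.mulLeft ℂ c)
    fun d => ?_
  refine AddMonoidHomClass.continuous_of_bound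
    ((f ∘ₗ LinearMap.mulLeft ℂ c) ∘ₗ LinearMap.mulRight ℂ d)
    (‖cls (functionalForm f hf) (star c)‖ * K * ‖cls (functionalForm f hf) d‖) fun a => ?_
  have h1 : f (c * (a * d)) =
      ⟪cls (functionalForm f hf) (star c), cls (functionalForm f hf) (a * d)⟫_ℂ := by
    rw [cls_inner, functionalForm_apply, star_star]
  change ‖f (c * (a * d))‖ ≤ _
  rw [h1]
  calc _ ≤ ‖cls (functionalForm f hf) (star c)‖ * ‖cls (functionalForm f hf) (a * d)‖ :=
        norm_inner_le_norm _ _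
    _ ≤ ‖cls (functionalForm f hf) (star c)‖ * (K * ‖a‖ * ‖cls (functionalForm f hf) d‖) := by
        gcongr; exact hKb f hf a d
    _ = _ := by ring

/-- After factoring a = cb this is Hermitian symmetry of the form at (b, c*). -/
theorem IsPosFunctional.map_star (hf : IsPosFunctional f) (he : IsApproxUnit e) (a : 𝔄) :
    f (star a) = (starRingEnd ℂ) (f a) := by
  obtain ⟨M, hM⟩ := he.bounded
  obtain ⟨c, b, rfl⟩ := exists_eq_mul hM he.tendsto_left a
  have := (functionalForm f hf).conj_symm b (star c)
  rw [functionalForm_apply, functionalForm_apply, star_star] at this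
  rw [this, star_mul]

/-- A bound through f(a*a) would need a continuous involution. The closed graph theorem avoids it:
([a] | [c]) = f(c*a) is continuous in a for fixed c. -/
theorem continuous_cls (hf : IsPosFunctional f) (he : IsApproxUnit e) :
    Continuous (cls (functionalForm f hf)) := by
  refine LinearMap.continuous_of_seq_closed_graph _ fun u x y hu hy => ?_
  refine (cls_dense (functionalForm f hf)).eq_of_inner_right ℂ fun c => ?_
  have h1 : Tendsto (fun n => ⟪cls (functionalForm f hf) c, cls (functionalForm f hf) (u n)⟫_ℂ)
      atTop (𝓝 ⟪cls (functionalForm f hf) c, y⟫_ℂ) := tendsto_const_nhds.inner hy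
  simp only [cls_inner, functionalForm_apply] at h1
  rw [cls_inner, functionalForm_apply]
  exact tendsto_nhds_unique h1 (((hf.continuous he).tendsto _).comp (hu.const_mul (star c)))

theorem exists_norm_cls_le (hf : IsPosFunctional f) (he : IsApproxUnit e) :
    ∃ C : ℝ, 0 ≤ C ∧ ∀ a, ‖cls (functionalForm f hf) a‖ ≤ C * ‖a‖ :=
  let T : 𝔄 →L[ℂ] Hilb (functionalForm f hf) := ⟨cls (functionalForm f hf), continuous_cls hf he⟩
  ⟨‖T‖, norm_nonneg T, T.le_opNorm⟩

/-- f(a*) is the limit of f(a* e_i) = ([e_i] | [a]), and the classes [e_i] are bounded. This makes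
[a] ↦ f(a) continuous, so that Riesz provides the cyclic vector. -/
theorem exists_norm_le_norm_cls (hf : IsPosFunctional f) (he : IsApproxUnit e) :
    ∃ C : ℝ, ∀ a, ‖f a‖ ≤ C * ‖cls (functionalForm f hf) a‖ := by
  obtain ⟨M, hM⟩ := he.bounded
  obtain ⟨C, hC, hCb⟩ := exists_norm_cls_le hf he
  refine ⟨C * M, fun a => ?_⟩
  have h1 : Tendsto (fun i => ‖f (star a * e i)‖) atTop (𝓝 ‖f (star a)‖) :=
    (((hf.continuous he).tendsto _).comp (he.tendsto_right (star a))).norm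
  rw [hf.map_star he, RCLike.norm_conj] at h1
  refine le_of_tendsto' h1 fun i => ?_
  rw [← functionalForm_apply hf, ← cls_inner, mul_comm]
  refine (norm_inner_le_norm _ _).trans ?_
  gcongr
  exact (hCb _).trans (by gcongr; exact hM i)

/-- Left multiplication by `a`, extended to the Hilbert space of a positive functional. -/
theorem exists_cls_mul_extension (hf : IsPosFunctional f) (a : 𝔄) :
    ∃ T : Hilb (functionalForm f hf) →L[ℂ] Hilb (functionalForm f hf),
      ∀ b, T (cls (functionalForm f hf) b) = cls (functionalForm f hf) (a * b) := by
  obtain ⟨K, hK, hKb⟩ := exists_norm_cls_mul_le 𝔄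
  have hn : ∀ b : PreHilb (functionalForm f hf),
      ‖b‖ = ‖cls (functionalForm f hf) ((toPre _).symm b)‖ := fun b =>
    (Completion.norm_coe b).symm
  refine ⟨(LinearMap.mkContinuous ((toPre (functionalForm f hf)).toLinearMap ∘ₗ
    LinearMap.mulLeft ℂ a ∘ₗ (toPre _).symm.toLinearMap) (K * ‖a‖) fun b => ?_).completion,
    fun b => ContinuousLinearMap.completion_apply_coe _ _⟩
  rw [hn, hn]
  exact hKb f hf a _

/-- The GNS construction from the bounds above; `gnsRep` is not available here because it
presupposes representability. -/
theorem IsPosFunctional.isRepresentable (hf : IsPosFunctional f) (he : IsApproxUnit e) :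
    IsRepresentable f := by
  choose T hT using exists_cls_mul_extension hf
  obtain ⟨C, hC⟩ := exists_norm_le_norm_cls hf he
  have hdense := cls_dense (functionalForm f hf)
  have text : ∀ {S S' : Hilb (functionalForm f hf) →L[ℂ] Hilb (functionalForm f hf)},
      (∀ b, S (cls _ b) = S' (cls _ b)) → S = S' := fun {S S'} h =>
    ContinuousLinearMap.ext <| congrFun <| hdense.equalizer S.continuous S'.continuous (funext h)
  let π : 𝔄 →⋆ₙₐ[ℂ] (Hilb (functionalForm f hf) →L[ℂ] Hilb (functionalForm f hf)) :=
    { toFun := T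
      map_smul' := fun c a => text fun b => by
        rw [hT, smul_mul_assoc, map_smul, ← hT]; rfl
      map_zero' := text fun b => by rw [hT, zero_mul, map_zero]; rfl
      map_add' := fun a a' => text fun b => by
        rw [hT, add_mul, map_add, add_apply, hT, hT]
      map_mul' := fun a a' => text fun b => by
        rw [hT, mul_apply_eq_comp, hT, hT, mul_assoc]
      map_star' := fun a => by
        rw [ContinuousLinearMap.star_eq_adjoint, ContinuousLinearMap.eq_adjoint_iff]
        intro x y
        refine hdense.induction_on₂ (p := fun x y => ⟪T (star a) x, y⟫_ℂ = ⟪x, T a y⟫_ℂ) ?_ ?_ x y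
        · exact isClosed_eq (by fun_prop) (by fun_prop)
        · intro b c
          rw [hT, hT, cls_inner, cls_inner, functionalForm_apply, functionalForm_apply, star_mul,
            star_star, mul_assoc] }
  let F : Hilb (functionalForm f hf) →L[ℂ] ℂ :=
    ((f ∘ₗ (toPre (functionalForm f hf)).symm.toLinearMap).mkContinuous C fun b =>
      (hC _).trans_eq (congrArg (C * ·) (Completion.norm_coe b))).fromCompletion
  have hF : ∀ a, F (cls _ a) = f a := fun a => ContinuousLinearMap.fromCompletion_apply_coe _ _
  let ζ := (InnerProductSpace.toDual ℂ (Hilb (functionalForm f hf))).symm F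
  have hζ : ∀ a, ⟪ζ, cls _ a⟫_ℂ = f a := fun a => by
    rw [InnerProductSpace.toDual_symm_apply, hF]
  have hπ : ∀ a, π a ζ = cls _ a := fun a => by
    refine hdense.eq_of_inner_left ℂ fun b => ?_
    have h : π a = star (π (star a)) := by rw [StarHomClass.map_star, star_star]
    rw [h, ContinuousLinearMap.star_eq_adjoint, ContinuousLinearMap.adjoint_inner_left]
    change ⟪ζ, T (star a) (cls _ b)⟫_ℂ = _
    rw [hT, hζ, cls_inner, functionalForm_apply]
  exact ⟨_, _, _, inferInstance, π, ζ, fun a => by rw [hπ, hζ]⟩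

end Representability


/-! ### Reduction of both parallel sums to one projection -/

/-- If `D` is invariant under `T`, then the projection onto its complement can be moved off the
second entry of `(P z | T P z)`. -/
theorem inner_projOrth_map_projOrth {H : Type*} [NormedAddCommGroup H] [InnerProductSpace ℂ H]
    [CompleteSpace H] (D : Submodule ℂ H) {T T' : H → H} (hadj : ∀ v w, ⟪v, T w⟫_ℂ = ⟪T' v, w⟫_ℂ)
    (hT : ∀ v ∈ D, T v ∈ D) (z : H) :
    ⟪projOrth D z, T (projOrth D z)⟫_ℂ = ⟪projOrth D z, T z⟫_ℂ := by
  have hmem : projOrth D z ∈ Dᗮ := Submodule.starProjection_apply_mem _ _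
  -- The complement of a `T`-invariant subspace is invariant under the adjoint `T'`.
  have hstar : T' (projOrth D z) ∈ Dᗮ := by
    rw [Submodule.mem_orthogonal']
    intro u hu
    rw [← hadj]
    exact (Submodule.mem_orthogonal' _ _).1 hmem _ (hT u hu)
  rw [hadj, hadj]
  change ⟪_, Dᗮ.starProjection z⟫_ℂ = _
  rw [← Submodule.inner_starProjection_left_eq_right,
    Submodule.starProjection_eq_self_iff.2 hstar]

section FormParallelSum

variable {V : Type*} [AddCommGroup V] [Module ℂ V]

/-- The classes `(x, x)` in the product of the Hilbert spaces of two forms. -/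
noncomputable def diagonalClasses (s t : NonnegForm V) : Submodule ℂ (WithLp 2 (Hilb s × Hilb t)) :=
  LinearMap.range ((WithLp.linearEquiv 2 ℂ (Hilb s × Hilb t)).symm.toLinearMap ∘ₗ
    (cls s).prod (cls t))

theorem mem_diagonalClasses {s t : NonnegForm V} {v : WithLp 2 (Hilb s × Hilb t)} :
    v ∈ diagonalClasses s t ↔ ∃ x, WithLp.toLp 2 (cls s x, cls t x) = v := Iff.rfl

/-- The form `(x, y) ↦ (Q (x, 0) | (y, 0))`, for the projection `Q` onto the complement of the
classes `(x, x)`. -/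
noncomputable def formParallelSum (s t : NonnegForm V) (x y : V) : ℂ :=
  ⟪WithLp.toLp 2 (cls s y, 0), projOrth (diagonalClasses s t) (WithLp.toLp 2 (cls s x, 0))⟫_ℂ

end FormParallelSum

/-- Only the two forms matter, so the operators can be replaced by the functionals having the same
forms. -/
theorem PosOp.parallelSum_apply {E : Type*} [NormedAddCommGroup E] [NormedSpace ℂ E]
    (A B : PosOp E) (x y : E) : A.parallelSum B x y = formParallelSum A.form B.form x y := by
  have h : ranJ A B = diagonalClasses A.form B.form := by
    ext v
    rw [mem_diagonalClasses]
    exact exists_congr fun x => by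
      rw [ContinuousLinearMap.coe_coe, adjJ_JSum]; rfl
  have h1 : A.parallelSum B x y = ⟪adjJ (JtildeL A B) y, opProj A B (adjJ (JtildeL A B) x)⟫_ℂ :=
    (adjJ_inner (JtildeL A B) y (opProj A B (adjJ (JtildeL A B) x))).symm
  rw [h1, adjJ_JtildeL, adjJ_JtildeL, opProj, h]
  rfl

section Functionals

variable {𝔄 : Type*} [NonUnitalRing 𝔄] [Module ℂ 𝔄] [IsScalarTower ℂ 𝔄 𝔄] [SMulCommClass ℂ 𝔄 𝔄]
  [StarRing 𝔄] [StarModule ℂ 𝔄] {f g : 𝔄 →ₗ[ℂ] ℂ}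

theorem diagSubspace_eq (hf : IsRepresentable f) (hg : IsRepresentable g) :
    diagSubspace hf hg =
      diagonalClasses (functionalForm f hf.isPos) (functionalForm g hg.isPos) := by
  ext v
  rw [mem_diagonalClasses]
  exact exists_congr fun a => by rw [gnsRep_gnsVec, gnsRep_gnsVec, eq_comm]

theorem projVec_eq (hf : IsRepresentable f) (hg : IsRepresentable g) :
    projVec hf hg = projOrth (diagonalClasses (functionalForm f hf.isPos)
      (functionalForm g hg.isPos)) (WithLp.toLp 2 (gnsVec hf, 0)) := by
  rw [projVec, projOrth, projOrth, diagSubspace_eq]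
  simp only [Submodule.orthogonal_closure]

theorem sumRep_inner (hf : IsRepresentable f) (hg : IsRepresentable g) (a : 𝔄)
    (v w : gnsSum hf hg) : ⟪v, sumRep hf hg a w⟫_ℂ = ⟪sumRep hf hg (star a) v, w⟫_ℂ := by
  rw [sumRep_apply, sumRep_apply, WithLp.prod_inner_apply, WithLp.prod_inner_apply]
  simp only [map_star, ContinuousLinearMap.star_eq_adjoint, ContinuousLinearMap.adjoint_inner_left]
  rfl

theorem sumRep_mem_diagonalClasses (hf : IsRepresentable f) (hg : IsRepresentable g) (a : 𝔄)
    {v : gnsSum hf hg}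
    (hv : v ∈ diagonalClasses (functionalForm f hf.isPos) (functionalForm g hg.isPos)) :
    sumRep hf hg a v ∈
      diagonalClasses (functionalForm f hf.isPos) (functionalForm g hg.isPos) := by
  obtain ⟨b, rfl⟩ := mem_diagonalClasses.1 hv
  refine mem_diagonalClasses.2 ⟨a * b, ?_⟩
  rw [sumRep_apply]
  exact congrArg (WithLp.toLp 2) (Prod.ext (gnsOp_cls hf a b).symm (gnsOp_cls hg a b).symm)

/-- `(f : g)(a) = (a ζ_f ⊕ 0 | P (ζ_f ⊕ 0))`, since `P` commutes with the representation. -/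
theorem functionalParallelSum_apply (hf : IsRepresentable f) (hg : IsRepresentable g) (a : 𝔄) :
    functionalParallelSum hf hg a = ⟪projVec hf hg, WithLp.toLp 2 (gnsCls hf a, 0)⟫_ℂ := by
  have h1 : (WithLp.toLp 2 (gnsCls hf a, 0) : gnsSum hf hg) =
      sumRep hf hg a (WithLp.toLp 2 (gnsVec hf, 0)) := by
    rw [sumRep_apply, ← gnsRep_gnsVec]
    exact congrArg (fun w => WithLp.toLp 2 (gnsRep hf a (gnsVec hf), w)) (map_zero _).symm
  change ⟪projVec hf hg, sumRep hf hg a (projVec hf hg)⟫_ℂ = _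
  rw [h1, projVec_eq]
  exact inner_projOrth_map_projOrth _ (sumRep_inner hf hg a)
    (fun v hv => sumRep_mem_diagonalClasses hf hg a hv) _

end Functionals

/-! ### Convergence along the approximate unit -/

section BanachStarAlgebra

variable {𝔄 : Type*} [NonUnitalNormedRing 𝔄] [NormedSpace ℂ 𝔄] [IsScalarTower ℂ 𝔄 𝔄]
    [SMulCommClass ℂ 𝔄 𝔄] [CompleteSpace 𝔄] [StarRing 𝔄] [StarModule ℂ 𝔄]
    {I : Type*} [Preorder I] [IsDirectedOrder I] [Nonempty I] {e : I → 𝔄}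
    {f g : 𝔄 →ₗ[ℂ] ℂ}

theorem exists_posOp_of_isPosFunctional (hf : IsPosFunctional f) (he : IsApproxUnit e) :
    ∃ A : PosOp 𝔄, ∀ a b, A.op a b = f (star b * a) := by
  obtain ⟨C, hC, hCb⟩ := exists_norm_cls_le hf he
  refine ⟨⟨LinearMap.mkContinuous₂ (functionalForm f hf).toMap (C * C) fun a b => ?_, hf⟩,
    fun a b => rfl⟩
  rw [← cls_inner]
  calc _ ≤ ‖cls (functionalForm f hf) b‖ * ‖cls (functionalForm f hf) a‖ := norm_inner_le_norm _ _
    _ ≤ (C * ‖b‖) * (C * ‖a‖) := by gcongr <;> exact hCb _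
    _ = _ := by ring

omit [CompleteSpace 𝔄] in
theorem PosOp.form_eq {A : PosOp 𝔄} (hf : IsPosFunctional f)
    (hA : ∀ a b, A.op a b = f (star b * a)) : A.form = functionalForm f hf := by
  have h : A.form.toMap = (functionalForm f hf).toMap := LinearMap.ext fun a =>
    LinearMap.ext fun b => hA a b
  cases hs : A.form
  cases ht : functionalForm f hf
  simpa [hs, ht] using h

/-- The classes of an approximate unit converge to the cyclic vector. -/
theorem tendsto_gnsCls (hf : IsRepresentable f) (he : IsApproxUnit e) :
    Tendsto (fun i => gnsCls hf (e i)) atTop (𝓝 (gnsVec hf)) := by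
  obtain ⟨M, hM⟩ := he.bounded
  obtain ⟨K, hK, hKb⟩ := exists_norm_cls_mul_le 𝔄
  have hop : ∀ a, ‖gnsRep hf a‖ ≤ K * ‖a‖ := fun a =>
    ContinuousLinearMap.opNorm_le_bound _ (by positivity) fun x =>
      (cls_dense (functionalForm f hf.isPos)).induction_on (p := fun x =>
        ‖gnsRep hf a x‖ ≤ K * ‖a‖ * ‖x‖) x (isClosed_le (by fun_prop) (by fun_prop)) fun b => by
          have := hKb f hf.isPos a b
          rwa [← gnsOp_cls] at this
  have hop' : ∀ i, ‖gnsRep hf (e i)‖ ≤ K * M := fun i => (hop _).trans (by gcongr; exact hM i)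
  have hcls := continuous_cls hf.isPos he
  simp only [← gnsRep_gnsVec]
  rw [Metric.tendsto_nhds]
  intro ε hε
  obtain ⟨i₀⟩ := ‹Nonempty I›
  have hM0 : 0 ≤ M := (norm_nonneg _).trans (hM i₀)
  -- Three-term estimate: the error δ = ‖[b] - ζ_f‖ enters once as it is and once multiplied by KM,
  -- so (KM + 1)δ < ε/2 is needed.
  obtain ⟨_, hb, b, rfl⟩ := Metric.dense_iff.1 (cls_dense (functionalForm f hf.isPos))
    (gnsVec hf) (ε / (2 * (K * M + 1))) (by positivity)
  rw [Metric.mem_ball, dist_eq_norm, lt_div_iff₀ (by positivity)] at hb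
  have hlim : Tendsto (fun i => gnsRep hf (e i) (gnsCls hf b)) atTop (𝓝 (gnsCls hf b)) :=
    ((hcls.tendsto _).comp (he.tendsto_left b)).congr fun i => (gnsOp_cls hf (e i) b).symm
  filter_upwards [Metric.tendsto_nhds.1 hlim (ε / 2) (by positivity)] with i hi
  rw [dist_eq_norm] at hi ⊢
  have e1 : gnsRep hf (e i) (gnsVec hf) - gnsVec hf =
      gnsRep hf (e i) (gnsVec hf - gnsCls hf b) + (gnsRep hf (e i) (gnsCls hf b) - gnsCls hf b)
        + (gnsCls hf b - gnsVec hf) := by rw [map_sub]; abel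
  have e2 : ‖gnsRep hf (e i) (gnsVec hf - gnsCls hf b)‖ ≤ K * M * ‖gnsCls hf b - gnsVec hf‖ := by
    rw [norm_sub_rev (gnsCls hf b)]
    exact ContinuousLinearMap.le_of_opNorm_le _ (hop' i) _
  rw [e1]
  have e3 := norm_add₃_le (a := gnsRep hf (e i) (gnsVec hf - gnsCls hf b))
    (b := gnsRep hf (e i) (gnsCls hf b) - gnsCls hf b) (c := gnsCls hf b - gnsVec hf)
  nlinarith

/-- Both functionals pair [a] ⊕ 0 with a fixed vector, so their distance in norm is at most C times
the distance of P([e_i] ⊕ 0) from P(ζ_f ⊕ 0). -/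
theorem exists_continuous_functionalParallelSum (hf : IsRepresentable f) (hg : IsRepresentable g)
    (he : IsApproxUnit e) {A B : PosOp 𝔄} (hA : ∀ a b, A.op a b = f (star b * a))
    (hB : ∀ a b, B.op a b = g (star b * a)) :
    ∃ h : 𝔄 →L[ℂ] ℂ, (∀ a, h a = functionalParallelSum hf hg a) ∧
      Tendsto (fun i => conjFunctional (A.parallelSum B (e i))) atTop (𝓝 h) := by
  obtain ⟨C, hC, hCb⟩ := exists_norm_cls_le hf.isPos he
  have hnorm : ∀ v : gnsH hf, ‖(WithLp.toLp 2 (v, 0) : gnsSum hf hg)‖ = ‖v‖ := fun v =>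
    WithLp.norm_toLp_fst 2 _ _ v
  have hbound : ∀ (v : gnsSum hf hg) (a : 𝔄),
      ‖⟪v, WithLp.toLp 2 (gnsCls hf a, 0)⟫_ℂ‖ ≤ ‖v‖ * C * ‖a‖ := fun v a => by
    refine (norm_inner_le_norm _ _).trans ?_
    rw [hnorm, mul_assoc]
    gcongr
    exact hCb a
  let h : 𝔄 →L[ℂ] ℂ := (functionalParallelSum hf hg).mkContinuous (‖projVec hf hg‖ * C) fun a => by
    rw [functionalParallelSum_apply]
    exact hbound _ a
  refine ⟨h, fun a => rfl, ?_⟩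
  set Q := projOrth (diagonalClasses (functionalForm f hf.isPos) (functionalForm g hg.isPos))
    with hQ
  have hval : ∀ i a, conjFunctional (A.parallelSum B (e i)) a =
      ⟪Q (WithLp.toLp 2 (gnsCls hf (e i), 0)), WithLp.toLp 2 (gnsCls hf a, 0)⟫_ℂ := fun i a => by
    change (starRingEnd ℂ) (A.parallelSum B (e i) a) = _
    rw [PosOp.parallelSum_apply, PosOp.form_eq hf.isPos hA, PosOp.form_eq hg.isPos hB,
      formParallelSum, inner_conj_symm]
  have hlim : Tendsto (fun i => ‖Q (WithLp.toLp 2 (gnsCls hf (e i), 0)) - projVec hf hg‖ * C)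
      atTop (𝓝 0) := by
    have h1 : Continuous fun v : gnsH hf => Q (WithLp.toLp 2 (v, 0)) :=
      Q.continuous.comp ((WithLp.prod_continuous_toLp 2 _ _).comp (by fun_prop))
    have h2 := (((h1.tendsto _).comp (tendsto_gnsCls hf he)).sub_const (projVec hf hg)).norm.mul_const C
    nth_rewrite 2 [projVec_eq] at h2
    rwa [sub_self, norm_zero, zero_mul] at h2
  rw [tendsto_iff_norm_sub_tendsto_zero]
  refine squeeze_zero (fun i => norm_nonneg _) (fun i => ?_) hlim
  refine ContinuousLinearMap.opNorm_le_bound _ (by positivity) fun a => ?_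
  have : (conjFunctional (A.parallelSum B (e i)) - h) a =
      ⟪Q (WithLp.toLp 2 (gnsCls hf (e i), 0)) - projVec hf hg, WithLp.toLp 2 (gnsCls hf a, 0)⟫_ℂ := by
    rw [inner_sub_left, ← hval, ← functionalParallelSum_apply]
    rfl
  rw [this]
  exact hbound _ a

end BanachStarAlgebra

end ParallelSum


theorem theorem5p5 {𝔄 : Type*} [NonUnitalNormedRing 𝔄] [NormedSpace ℂ 𝔄] [IsScalarTower ℂ 𝔄 𝔄]
    [SMulCommClass ℂ 𝔄 𝔄] [CompleteSpace 𝔄] [StarRing 𝔄] [StarModule ℂ 𝔄]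
    {I : Type*} [Preorder I] [IsDirectedOrder I] [Nonempty I]
    (e : I → 𝔄) (he : ParallelSum.IsApproxUnit e)
    (f g : 𝔄 →ₗ[ℂ] ℂ)
    (hf : ParallelSum.IsPosFunctional f) (hg : ParallelSum.IsPosFunctional g) :
    ∃ (hf' : ParallelSum.IsRepresentable f) (hg' : ParallelSum.IsRepresentable g)
      (A B : ParallelSum.PosOp 𝔄),
      (∀ a b, A.op a b = f (star b * a)) ∧
      (∀ a b, B.op a b = g (star b * a)) ∧
      ∃ h : 𝔄 →L[ℂ] ℂ,
        (∀ a, h a = ParallelSum.functionalParallelSum hf' hg' a) ∧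
        Tendsto (fun i => ParallelSum.conjFunctional (A.parallelSum B (e i))) atTop (𝓝 h) := by
  obtain ⟨A, hA⟩ := ParallelSum.exists_posOp_of_isPosFunctional hf he
  obtain ⟨B, hB⟩ := ParallelSum.exists_posOp_of_isPosFunctional hg he
  exact ⟨hf.isRepresentable he, hg.isRepresentable he, A, B, hA, hB,
    ParallelSum.exists_continuous_functionalParallelSum _ _ he hA hB⟩
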